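/- Lemma 4.1 (Poisson cohomology ≅ 0-de Rham cohomology). Let $S$ be a smooth surface (a Hausdorff, second countable $2$-manifold without boundary) with a star divisor $D=\{Z_1,\dots,Z_n\}$, i.e. a finite collection of smooth curves, each a closed embedded submanifold of $S$, that are pairwise transverse. Let ${}^bTS$ be the Lie algebroid whose sections are the smooth vector fields on $S$ tangent to every $Z_i$, and let ${}^0TS$ (the zero tangent bundle) be the Lie algebroid whose sections are the smooth vector fields on $S$ that vanish at every point of every $Z_i$; in both cases the anchor is evaluation in $TS$ and the bracket is induced by the Lie bracket of vector fields. Let $\omega$ be a star log symplectic structure on $(S,D)$, i.e. a closed nondegenerate section of $\wedge^2({}^bT^*S)$, and let $\pi$ be the associated star log Poisson structure: the bivector field on $S$ with $\pi^\sharp=(\omega^\flat)^{-1}$, i.e. for every smooth $1$-form $\alpha$ on $S$, $\pi^\sharp(\alpha)=\pi(\alpha,\cdot)$ is the section $u$ of ${}^bTS$ with $\omega(u,v)=\alpha(v)$ for all sections $v$ of ${}^bTS$. Let $H^k_\pi(S)$ be the Poisson cohomology of $\pi$, i.e. the cohomology of the complex $\Gamma(\wedge^\bullet TS)$ of multivector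 fields with the Lichnerowicz differential, which is the Lie algebroid differential of $T^*S$ with anchor $\pi^\sharp$ and bracket $[\alpha,\beta]=\mathcal L_{\pi^\sharp(\alpha)}\beta-\mathcal L_{\pi^\sharp(\beta)}\alpha-d(\pi(\alpha,\beta))$. Let ${}^0H^k(S)$ be the Lie algebroid cohomology of ${}^0TS$. Then, for every $k\ge 0$, $$H^k_\pi(S)\;\cong\;{}^0H^k(S)$$ as real vector spaces. Moreover the rigged Lie algebroid of $\omega$, whose sections are the sections $u$ of ${}^bTS$ for which there is a smooth $1$-form $\alpha$ on $S$ with $\omega(u,v)=\alpha(v)$ for all sections $v$ of ${}^bTS$, coincides with the zero tangent bundle ${}^0TS$ (same sections, with bracket and anchor those induced from $TS$). -/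

import Mathlib

open scoped Manifold ContDiff

noncomputable section

namespace StarLog

/-! ### Lie algebroid forms and their cohomology, on the level of global sections

`R` is the algebra of smooth functions.  A Lie algebroid is given by its `R`-module of sections
`A`, its bracket and its anchor; its `k`-forms, i.e. the sections of the `k`-th exterior power of
the dual bundle, are the `R`-multilinear alternating maps `A ^ k → R`. -/

section Algebra

variable {R : Type*} [CommRing R] [Algebra ℝ R]

/-- Vector fields, as derivations of the algebra of smooth functions.  They form an `R`-module,
and Mathlib's bracket on them is the commutator, i.e. the Lie bracket of vector fields. -/
abbrev VField (R : Type*) [CommRing R] [Algebra ℝ R] : Type _ := Derivation ℝ R R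

/-- One-forms: the `R`-module dual of the vector fields. -/
abbrev OneForm (R : Type*) [CommRing R] [Algebra ℝ R] : Type _ := Module.Dual R (VField R)

/-- Bivector fields: alternating `R`-bilinear maps on one-forms. -/
abbrev Bivector (R : Type*) [CommRing R] [Algebra ℝ R] : Type _ := OneForm R [⋀^Fin 2]→ₗ[R] R

section Cohomology

variable {A : Type*} [AddCommGroup A] [Module R A]

variable (R A) in
/-- The `k`-forms of the Lie algebroid, as a real vector space. -/
def Form (k : ℕ) : Type _ := A [⋀^Fin k]→ₗ[R] R

instance (k : ℕ) : AddCommGroup (Form R A k) := inferInstanceAs (AddCommGroup (A [⋀^Fin k]→ₗ[R] R))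

instance (k : ℕ) : Module ℝ (Form R A k) := inferInstanceAs (Module ℝ (A [⋀^Fin k]→ₗ[R] R))

instance (k : ℕ) : CoeFun (Form R A k) (fun _ => (Fin k → A) → R) :=
  ⟨fun β => (show A [⋀^Fin k]→ₗ[R] R from β)⟩

/-- The bracket part `∑_{i<j} (-1)^(i+j) β([v_i, v_j], v_0, …, v̂_i, …, v̂_j, …, v_k)` of the
differential.  For a form of positive degree `m + 1` the pair is written `i`, `j + 1` with
`i ≤ j` in `Fin (m + 1)`; the remaining arguments are listed in increasing order. -/
def bracketPart (br : A → A → A) :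
    {k : ℕ} → (A [⋀^Fin k]→ₗ[R] R) → (Fin (k + 1) → A) → R
  | 0, _, _ => 0
  | m + 1, β, v =>
      ∑ j : Fin (m + 1), ∑ i ∈ Finset.Iic j, (-1 : R) ^ ((i : ℕ) + ((j : ℕ) + 1)) *
        β (Fin.cons (br (v i.castSucc) (v j.succ))
          (fun l : Fin m => v (j.succ.succAbove (i.succAbove l))))

/-- The Lie algebroid differential
`(dβ)(v_0, …, v_k) = ∑_i (-1)^i ρ(v_i)(β(v_0, …, v̂_i, …, v_k))
  + ∑_{i<j} (-1)^(i+j) β([v_i, v_j], v_0, …, v̂_i, …, v̂_j, …, v_k)`. -/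
def algebroidD (br : A → A → A) (ρ : A → VField R) {k : ℕ} (β : A [⋀^Fin k]→ₗ[R] R)
    (v : Fin (k + 1) → A) : R :=
  (∑ i : Fin (k + 1), (-1 : R) ^ (i : ℕ) * ρ (v i) (β (fun l => v (i.succAbove l))))
    + bracketPart br β v

theorem algebroidD_add (br : A → A → A) (ρ : A → VField R) {k : ℕ}
    (β γ : A [⋀^Fin k]→ₗ[R] R) (v : Fin (k + 1) → A) :
    algebroidD br ρ (β + γ) v = algebroidD br ρ β v + algebroidD br ρ γ v := by
  cases k with
  | zero => simp [algebroidD, bracketPart]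
  | succ m =>
    simp only [algebroidD, bracketPart, AlternatingMap.add_apply, map_add, mul_add,
      Finset.sum_add_distrib]
    ring

theorem algebroidD_smul (br : A → A → A) (ρ : A → VField R) {k : ℕ} (c : ℝ)
    (β : A [⋀^Fin k]→ₗ[R] R) (v : Fin (k + 1) → A) :
    algebroidD br ρ (c • β) v = c • algebroidD br ρ β v := by
  cases k with
  | zero => simp [algebroidD, bracketPart]
  | succ m =>
    simp only [algebroidD, bracketPart, AlternatingMap.smul_apply, mul_smul_comm,
      Finset.smul_sum, smul_add, Derivation.map_smul]

variable (R) in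
/-- Closed `k`-forms of the Lie algebroid. -/
def cocycles (br : A → A → A) (ρ : A → VField R) (k : ℕ) : Submodule ℝ (Form R A k) where
  carrier := {β | ∀ v, algebroidD br ρ β v = 0}
  add_mem' := fun {a b} ha hb v =>
    (algebroidD_add br ρ a b v).trans (by rw [ha v, hb v, add_zero])
  zero_mem' := fun v => by
    have h := algebroidD_smul br ρ (0 : ℝ) (0 : A [⋀^Fin k]→ₗ[R] R) v
    rw [zero_smul, zero_smul] at h
    exact h
  smul_mem' := fun c β hb v => (algebroidD_smul br ρ c β v).trans (by rw [hb v, smul_zero])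

variable (R) in
/-- Exact `k`-forms of the Lie algebroid. -/
def coboundaries (br : A → A → A) (ρ : A → VField R) : (k : ℕ) → Submodule ℝ (Form R A k)
  | 0 => ⊥
  | k + 1 =>
    { carrier := {β | ∃ γ : Form R A k, ∀ v, β v = algebroidD br ρ γ v}
      add_mem' := by
        rintro a b ⟨γ, hγ⟩ ⟨δ, hδ⟩
        refine ⟨γ + δ, fun v => Eq.trans ?_ (algebroidD_add br ρ γ δ v).symm⟩
        rw [← hγ v, ← hδ v]
        rfl
      zero_mem' := ⟨0, fun v => by
        have h := algebroidD_smul br ρ (0 : ℝ) (0 : A [⋀^Fin k]→ₗ[R] R) v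
        rw [zero_smul, zero_smul] at h
        exact h.symm⟩
      smul_mem' := by
        rintro c a ⟨γ, hγ⟩
        refine ⟨c • γ, fun v => Eq.trans ?_ (algebroidD_smul br ρ c γ v).symm⟩
        rw [← hγ v]
        rfl }

variable (R) in
/-- The Lie algebroid cohomology in degree `k`: closed forms modulo exact forms. -/
abbrev AlgebroidCohomology (br : A → A → A) (ρ : A → VField R) (k : ℕ) : Type _ :=
  cocycles R br ρ k ⧸ (coboundaries R br ρ k).submoduleOf (cocycles R br ρ k)

end Cohomology

/-! ### Poisson cohomology -/

/-- The differential of a function: `(df)(X) = X f`. -/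
def dFun (f : R) : OneForm R where
  toFun X := X f
  map_add' _ _ := rfl
  map_smul' _ _ := rfl

/-- The Lie derivative of a one-form: `(L_X β)(Y) = X(β(Y)) - β([X, Y])`. -/
def lieDer (X : VField R) (β : OneForm R) : OneForm R where
  toFun Y := X (β Y) - β ⁅X, Y⁆
  map_add' Y Z := by
    simp only [map_add, lie_add]
    ring
  map_smul' f Y := by
    have h : ⁅X, f • Y⁆ = (X f) • Y + f • ⁅X, Y⁆ := by
      ext g
      simp only [Derivation.commutator_apply, Derivation.add_apply, Derivation.smul_apply,
        smul_eq_mul, Derivation.leibniz]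
      ring
    simp only [map_smul, h, map_add, smul_eq_mul, Derivation.leibniz, RingHom.id_apply]
    ring

theorem bivector_smul_right (π : Bivector R) (α β : OneForm R) (f : R) :
    π ![α, f • β] = f * π ![α, β] := by
  have h (x : OneForm R) : ![α, x] = Function.update ![α, 0] 1 x := by
    ext i : 1
    fin_cases i <;> simp
  rw [h (f • β), h β, π.map_update_smul, smul_eq_mul]

theorem bivector_add_right (π : Bivector R) (α β γ : OneForm R) :
    π ![α, β + γ] = π ![α, β] + π ![α, γ] := by
  have h (x : OneForm R) : ![α, x] = Function.update ![α, 0] 1 x := by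
    ext i : 1
    fin_cases i <;> simp
  rw [h (β + γ), h β, h γ, π.map_update_add]

theorem bivector_dFun_add (π : Bivector R) (α : OneForm R) (f g : R) :
    π ![α, dFun (f + g)] = π ![α, dFun f] + π ![α, dFun g] := by
  have h : (dFun (f + g) : OneForm R) = dFun f + dFun g := by
    ext X
    simp [dFun]
  rw [h]
  exact bivector_add_right π α (dFun f) (dFun g)

/-- The map `π♯` from one-forms to vector fields, `π♯ α = π(α, ·)`, that is
`(π♯ α) f = π(α, df)`. -/
def sharp (π : Bivector R) (α : OneForm R) : VField R :=
  Derivation.mk'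
    { toFun := fun f => π ![α, dFun f]
      map_add' := bivector_dFun_add π α
      map_smul' := fun c f => by
        have h : (dFun (c • f) : OneForm R) = (algebraMap ℝ R c) • dFun f := by
          ext X
          simp [dFun]
        rw [h, bivector_smul_right, RingHom.id_apply, Algebra.smul_def] }
    (fun f g => by
      have h : (dFun (f * g) : OneForm R) = f • dFun g + g • dFun f := by
        ext X
        simp [dFun]
      change π ![α, dFun (f * g)] = f • π ![α, dFun g] + g • π ![α, dFun f]
      rw [h, bivector_add_right, bivector_smul_right, bivector_smul_right]
      rfl)

/-- The bracket of one-forms defined by a bivector field,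
`[α, β] = L_{π♯ α} β - L_{π♯ β} α - d(π(α, β))`. -/
def cotangentBracket (π : Bivector R) (α β : OneForm R) : OneForm R :=
  lieDer (sharp π α) β - lieDer (sharp π β) α - dFun (π ![α, β])

/-- The Poisson cohomology of `π`: the cohomology of the multivector fields, i.e. of the
`R`-multilinear alternating maps on one-forms, under the Lichnerowicz differential, which is the
Lie algebroid differential of the cotangent bundle with anchor `π♯`. -/
abbrev PoissonCohomology (π : Bivector R) (k : ℕ) : Type _ :=
  AlgebroidCohomology R (cotangentBracket π) (sharp π) k

end Algebra

/-! ### Surfaces with a star divisor -/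

section Surface

variable {S : Type*} [TopologicalSpace S] [ChartedSpace (EuclideanSpace ℝ (Fin 2)) S]

/-- The algebra of smooth real functions on the surface `S`. -/
abbrev Smooth (S : Type*) [TopologicalSpace S] [ChartedSpace (EuclideanSpace ℝ (Fin 2)) S] :
    Type _ := C^∞⟮𝓡 2, S; 𝓘(ℝ, ℝ), ℝ⟯

/-- `Z` is a smooth curve which is a closed embedded submanifold: near each of its points it is the
zero set of a smooth function with nonzero differential. -/
def IsSmoothClosedCurve (Z : Set S) : Prop :=
  IsClosed Z ∧ ∀ p ∈ Z, ∃ f : Smooth S,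
    mfderiv (𝓡 2) 𝓘(ℝ, ℝ) f p ≠ 0 ∧ ∀ᶠ q in nhds p, (q ∈ Z ↔ f q = 0)

/-- The tangent space of `Z` at `p`: the tangent vectors of `S` killed by the differentials of all
smooth functions that vanish on `Z`. -/
def tangentTo (Z : Set S) (p : S) : Submodule ℝ (TangentSpace (𝓡 2) p) :=
  ⨅ (f : Smooth S) (_ : ∀ q ∈ Z, f q = 0),
    LinearMap.ker (mfderiv (𝓡 2) 𝓘(ℝ, ℝ) f p).toLinearMap

/-- A star divisor: a finite collection of smooth closed curves that are pairwise transverse. -/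
structure IsStarDivisor {n : ℕ} (D : Fin n → Set S) : Prop where
  curve : ∀ i, IsSmoothClosedCurve (D i)
  transverse : ∀ i j, i ≠ j → ∀ p ∈ D i ∩ D j, tangentTo (D i) p ⊔ tangentTo (D j) p = ⊤

variable {n : ℕ} (D : Fin n → Set S)

/-- Sections of the `b`-tangent bundle: the vector fields tangent to every curve of `D`. -/
def bFields : Submodule (Smooth S) (VField (Smooth S)) where
  carrier := {X | ∀ i, ∀ f : Smooth S, (∀ q ∈ D i, f q = 0) → ∀ q ∈ D i, (X f) q = 0}
  add_mem' := fun {X Y} hX hY i f hf q hq => by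
    change (X f) q + (Y f) q = 0
    rw [hX i f hf q hq, hY i f hf q hq, add_zero]
  zero_mem' := fun _ _ _ _ _ => rfl
  smul_mem' := fun g X hX i f hf q hq => by
    change g q * (X f) q = 0
    rw [hX i f hf q hq, mul_zero]

/-- Sections of the zero tangent bundle: the vector fields vanishing on every curve of `D`. -/
def zeroFields : Submodule (Smooth S) (VField (Smooth S)) where
  carrier := {X | ∀ i, ∀ q ∈ D i, ∀ f : Smooth S, (X f) q = 0}
  add_mem' := fun {X Y} hX hY i q hq f => by
    change (X f) q + (Y f) q = 0
    rw [hX i q hq f, hY i q hq f, add_zero]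
  zero_mem' := fun _ _ _ _ => rfl
  smul_mem' := fun g X hX i q hq f => by
    change g q * (X f) q = 0
    rw [hX i q hq f, mul_zero]

/-- The bracket of the `b`-tangent bundle, induced by that of vector fields. -/
def bBracket (X Y : bFields D) : bFields D :=
  ⟨⁅(X : VField (Smooth S)), (Y : VField (Smooth S))⁆, fun i f hf q hq => by
    rw [Derivation.commutator_apply]
    change ((X : VField (Smooth S)) ((Y : VField (Smooth S)) f)) q
      - ((Y : VField (Smooth S)) ((X : VField (Smooth S)) f)) q = 0
    rw [X.2 i _ (fun r hr => Y.2 i f hf r hr) q hq, Y.2 i _ (fun r hr => X.2 i f hf r hr) q hq,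
      sub_zero]⟩

/-- The bracket of the zero tangent bundle, induced by that of vector fields. -/
def zeroBracket (X Y : zeroFields D) : zeroFields D :=
  ⟨⁅(X : VField (Smooth S)), (Y : VField (Smooth S))⁆, fun i q hq f => by
    rw [Derivation.commutator_apply]
    change ((X : VField (Smooth S)) ((Y : VField (Smooth S)) f)) q
      - ((Y : VField (Smooth S)) ((X : VField (Smooth S)) f)) q = 0
    rw [X.2 i q hq _, Y.2 i q hq _, sub_zero]⟩

/-- The Lie algebroid cohomology of the zero tangent bundle; the anchor is evaluation. -/
abbrev ZeroCohomology (k : ℕ) : Type _ :=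
  AlgebroidCohomology (Smooth S) (zeroBracket D)
    (fun X : zeroFields D => (X : VField (Smooth S))) k

/-- Two-forms of the `b`-tangent bundle. -/
abbrev BTwoForm : Type _ := bFields D [⋀^Fin 2]→ₗ[Smooth S] (Smooth S)

/-- A star log symplectic structure: a `b`-two-form that is closed and nondegenerate, i.e. such
that `u ↦ Ω(u, ·)` is a bijection from the sections of the `b`-tangent bundle to those of its
dual. -/
structure IsStarLogSymplectic (Ω : BTwoForm D) : Prop where
  closed : ∀ v, algebroidD (R := Smooth S) (bBracket D)
    (fun X : bFields D => (X : VField (Smooth S))) Ω v = 0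
  nondegenerate : ∀ α : Module.Dual (Smooth S) (bFields D), ∃! u : bFields D,
    ∀ v : bFields D, Ω ![u, v] = α v

/-- The bivector field `π` on `S` is the inverse of the `b`-two-form `Ω`: `π♯ α` is the `b`-vector
field `u` with `Ω(u, ·) = α`. -/
def IsInverse (Ω : BTwoForm D) (π : Bivector (Smooth S)) : Prop :=
  ∀ (α : OneForm (Smooth S)) (u : bFields D),
    (∀ v : bFields D, Ω ![u, v] = α (v : VField (Smooth S))) →
      sharp π α = (u : VField (Smooth S))

variable {D}

theorem bTwoForm_add_left (Ω : BTwoForm D) (u u' v : bFields D) :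
    Ω ![u + u', v] = Ω ![u, v] + Ω ![u', v] := by
  have h (x : bFields D) : ![x, v] = Function.update ![0, v] 0 x := by
    ext i : 1
    fin_cases i <;> simp
  rw [h (u + u'), h u, h u', Ω.map_update_add]

theorem bTwoForm_smul_left (Ω : BTwoForm D) (f : Smooth S) (u v : bFields D) :
    Ω ![f • u, v] = f * Ω ![u, v] := by
  have h (x : bFields D) : ![x, v] = Function.update ![0, v] 0 x := by
    ext i : 1
    fin_cases i <;> simp
  rw [h (f • u), h u, Ω.map_update_smul, smul_eq_mul]

/-- Sections of the rigged Lie algebroid of `Ω`: the `b`-vector fields `u` for which `Ω(u, ·)` is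
(the restriction of) a smooth one-form on `S`.  Bracket and anchor are those of vector fields. -/
def rigged (Ω : BTwoForm D) : Submodule (Smooth S) (VField (Smooth S)) where
  carrier := {X | ∃ u : bFields D, (u : VField (Smooth S)) = X ∧
    ∃ α : OneForm (Smooth S), ∀ v : bFields D, Ω ![u, v] = α (v : VField (Smooth S))}
  add_mem' := by
    rintro X Y ⟨u, rfl, α, hα⟩ ⟨w, rfl, β, hβ⟩
    exact ⟨u + w, rfl, α + β, fun v => by
      rw [bTwoForm_add_left, hα v, hβ v, LinearMap.add_apply]⟩
  zero_mem' := ⟨0, rfl, 0, fun v => by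
    have h := bTwoForm_smul_left Ω 0 0 v
    simpa using h⟩
  smul_mem' := by
    rintro f X ⟨u, rfl, α, hα⟩
    exact ⟨f • u, rfl, f • α, fun v => by
      rw [bTwoForm_smul_left, hα v, LinearMap.smul_apply, smul_eq_mul]⟩

end Surface

end StarLog

end

/-! The map `π♯` is an isomorphism of Lie algebroids from the cotangent bundle to the zero tangent
bundle, and isomorphic Lie algebroids have isomorphic cohomology (`nonempty_cohomology_equiv`).

Compatibility with brackets (`sharp_cotangentBracket`) is the closedness of `Ω`, read through `Ω(π♯
α, ·) = α`. Surjectivity onto the rigged algebroid is built into its definition. Injectivity holds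
because a one-form that kills all `b`-fields vanishes off the divisor, which is dense.

The geometric content is `rigged_eq_zeroFields`. Near a point let `F` be the product of the defining
functions of the curves through it, and let `det` be the determinant of two fields in coordinates.
The `b`-tangent bundle has a local frame `e₁`, `e₂` with `det(e₁, e₂) = c F`, `c` a unit
(`IsTransverseFamily.exists_frame`). Hence `Ω = h det / (c F)` with `h = Ω(e₁, e₂)`, and
nondegeneracy makes `h` a unit (`bTwoForm_frame_ne_zero`). So `Ω(u, ·)` extends to all vector fields
exactly when the components of `u` are divisible by `F`. By transversality this means that `u`
vanishes on every curve (`IsTransverseFamily.exists_eq_prod_mul`).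

Arbitrarily many curves may meet at a point, so there is no normal form such as `x y = 0`. The frame
is built one curve at a time, by dividing germs on the line (`germ_dvd_or_dvd`). Since sections are
global, germs are represented by global functions through bump functions, and identities are checked
off the divisor and extended by density. -/

open scoped Topology
open Filter

namespace StarLog

/-! ### Calculus: parametric integrals and Hadamard's lemma -/

section Calculus

theorem hasFDerivAt_parametric_integral {E F : Type} [NormedAddCommGroup E] [NormedSpace ℝ E]
    [ProperSpace E] [NormedAddCommGroup F] [NormedSpace ℝ F]
    {f : E × ℝ → F} (hf : ContDiff ℝ 1 f) (x₀ : E) :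
    HasFDerivAt (fun x => ∫ t in (0 : ℝ)..1, f (x, t))
      (∫ t in (0 : ℝ)..1, (fderiv ℝ f (x₀, t)).comp (ContinuousLinearMap.inl ℝ E ℝ)) x₀ := by
  have hf' : Continuous fun z : E × ℝ =>
      (fderiv ℝ f z).comp (ContinuousLinearMap.inl ℝ E ℝ) :=
    (hf.continuous_fderiv one_ne_zero).clm_comp continuous_const
  obtain ⟨C, hC⟩ := ((isCompact_closedBall x₀ 1).prod
    (isCompact_Icc (a := (0 : ℝ)) (b := 1))).exists_bound_of_continuousOn hf'.continuousOn
  refine (intervalIntegral.hasFDerivAt_integral_of_dominated_of_fderiv_le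
    (F := fun x t => f (x, t)) (bound := fun _ => C)
    (F' := fun x t => (fderiv ℝ f (x, t)).comp (ContinuousLinearMap.inl ℝ E ℝ))
    (Metric.closedBall_mem_nhds x₀ one_pos) ?_ ?_ ?_ ?_ ?_ ?_)
  · exact Eventually.of_forall fun x =>
      (hf.continuous.comp (Continuous.prodMk_right x)).aestronglyMeasurable
  · exact (hf.continuous.comp (Continuous.prodMk_right x₀)).intervalIntegrable _ _
  · exact (hf'.comp (Continuous.prodMk_right x₀)).aestronglyMeasurable
  · refine Eventually.of_forall fun t ht x hx => hC _ ⟨hx, ?_⟩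
    rw [Set.uIoc_of_le zero_le_one] at ht
    exact ⟨ht.1.le, ht.2⟩
  · exact intervalIntegrable_const
  · refine Eventually.of_forall fun t _ x _ => ?_
    have h := (hf.differentiable one_ne_zero (x, t)).hasFDerivAt
    exact h.comp x (hasFDerivAt_prodMk_left x t)

/-- The target `F` is quantified inside the induction because the derivative is again a parametric
integral, now with values in linear maps. -/
theorem contDiff_parametric_integral_nat {E : Type} [NormedAddCommGroup E] [NormedSpace ℝ E]
    [ProperSpace E] (n : ℕ) : ∀ {F : Type} [NormedAddCommGroup F] [NormedSpace ℝ F]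
    {f : E × ℝ → F}, ContDiff ℝ ∞ f → ContDiff ℝ n (fun x => ∫ t in (0 : ℝ)..1, f (x, t)) := by
  induction n with
  | zero =>
    intro F _ _ f hf
    refine contDiff_zero.2 (continuous_iff_continuousAt.2 fun x => ?_)
    exact (hasFDerivAt_parametric_integral (hf.of_le (by simp)) x).continuousAt
  | succ n ih =>
    intro F _ _ f hf
    have h1 : ContDiff ℝ 1 f := hf.of_le (by simp)
    refine contDiff_succ_iff_hasFDerivAt.2 ⟨_, ?_, fun x => hasFDerivAt_parametric_integral h1 x⟩
    exact ih (f := fun z => (fderiv ℝ f z).comp (ContinuousLinearMap.inl ℝ E ℝ))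
      ((hf.fderiv_right (by simp)).clm_comp contDiff_const)

theorem contDiff_parametric_integral {E F : Type} [NormedAddCommGroup E] [NormedSpace ℝ E]
    [ProperSpace E] [NormedAddCommGroup F] [NormedSpace ℝ F]
    {f : E × ℝ → F} (hf : ContDiff ℝ ∞ f) :
    ContDiff ℝ ∞ (fun x => ∫ t in (0 : ℝ)..1, f (x, t)) :=
  contDiff_infty.2 fun n => contDiff_parametric_integral_nat n hf

/-- Hadamard's lemma for smooth functions on a vector space, along the fibres of an affine
projection: `f z - f (c z)` is the value of a smooth family of linear forms on `z - c z`. -/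
theorem hadamard {E : Type} [NormedAddCommGroup E] [NormedSpace ℝ E] [ProperSpace E]
    {f : E → ℝ} (hf : ContDiff ℝ ∞ f) {c : E → E} (hc : ContDiff ℝ ∞ c) :
    ∃ L : E → E →L[ℝ] ℝ, ContDiff ℝ ∞ L ∧ (∀ z, f z - f (c z) = L z (z - c z)) ∧
      ∀ z, c z = z → L z = fderiv ℝ f z := by
  have hp : ContDiff ℝ ∞ fun w : E × ℝ => c w.1 + w.2 • (w.1 - c w.1) := by
    have := hc.comp (contDiff_fst (E := E) (F := ℝ) (n := ∞) (𝕜 := ℝ))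
    exact this.add (contDiff_snd.smul (contDiff_fst.sub this))
  have hg : ContDiff ℝ ∞ fun w : E × ℝ => fderiv ℝ f (c w.1 + w.2 • (w.1 - c w.1)) :=
    (hf.fderiv_right (m := ∞) (by simp)).comp hp
  -- `L z` averages the derivative of `f` over the segment from `c z` to `z`; when `c z = z` the
  -- segment is a point.
  refine ⟨fun z => ∫ t in (0 : ℝ)..1, fderiv ℝ f (c z + t • (z - c z)),
    contDiff_parametric_integral hg, fun z => ?_, fun z hz => by simp [hz]⟩
  have hcont : Continuous fun t : ℝ => fderiv ℝ f (c z + t • (z - c z)) :=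
    hg.continuous.comp (Continuous.prodMk_right z)
  beta_reduce
  rw [ContinuousLinearMap.intervalIntegral_apply (hcont.intervalIntegrable _ _)]
  have hder (t : ℝ) : HasDerivAt (fun t : ℝ => f (c z + t • (z - c z)))
      (fderiv ℝ f (c z + t • (z - c z)) (z - c z)) t := by
    have h1 : HasDerivAt (fun t : ℝ => c z + t • (z - c z)) (z - c z) t := by
      simpa using ((hasDerivAt_id t).smul_const (z - c z)).const_add (c z)
    exact ((hf.differentiable (by simp) _).hasFDerivAt).comp_hasDerivAt t h1
  rw [intervalIntegral.integral_eq_sub_of_hasDerivAt (fun t _ => hder t)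
    ((hcont.clm_apply continuous_const).intervalIntegrable _ _)]
  simp

/-- Hadamard's lemma in the plane, at a point. -/
theorem hadamard_point {H : ℝ × ℝ → ℝ} (hH : ContDiff ℝ ∞ H) (z₀ : ℝ × ℝ) :
    ∃ H₁ H₂ : ℝ × ℝ → ℝ, ContDiff ℝ ∞ H₁ ∧ ContDiff ℝ ∞ H₂ ∧
      (∀ z, H z = H z₀ + (z.1 - z₀.1) * H₁ z + (z.2 - z₀.2) * H₂ z) ∧
      H₁ z₀ = fderiv ℝ H z₀ (1, 0) ∧ H₂ z₀ = fderiv ℝ H z₀ (0, 1) := by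
  obtain ⟨L, hL, h, hd⟩ := hadamard hH (c := fun _ => z₀) contDiff_const
  refine ⟨fun z => L z (1, 0), fun z => L z (0, 1), hL.clm_apply contDiff_const,
    hL.clm_apply contDiff_const, fun z => ?_, by simp [hd z₀ rfl], by simp [hd z₀ rfl]⟩
  have hz : z - z₀ = (z.1 - z₀.1) • ((1, 0) : ℝ × ℝ) + (z.2 - z₀.2) • ((0, 1) : ℝ × ℝ) := by
    ext <;> simp
  have := h z
  rw [hz, map_add, map_smul, map_smul, smul_eq_mul, smul_eq_mul] at this
  linarith

/-- Hadamard's lemma in the plane, along the first coordinate. -/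
theorem hadamard_fst {H : ℝ × ℝ → ℝ} (hH : ContDiff ℝ ∞ H) :
    ∃ H₁ : ℝ × ℝ → ℝ, ContDiff ℝ ∞ H₁ ∧ ∀ z, H z = H (0, z.2) + z.1 * H₁ z := by
  obtain ⟨L, hL, h, -⟩ := hadamard hH (c := fun z : ℝ × ℝ => (0, z.2))
    (contDiff_const.prodMk contDiff_snd)
  refine ⟨fun z => L z (1, 0), hL.clm_apply contDiff_const, fun z => ?_⟩
  have hz : z - (0, z.2) = z.1 • ((1, 0) : ℝ × ℝ) := by ext <;> simp
  have := h z
  rw [hz, map_smul, smul_eq_mul] at this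
  linarith

/-- Hadamard's lemma on the line. -/
theorem hadamard_line {φ : ℝ → ℝ} (hφ : ContDiff ℝ ∞ φ) :
    ∃ ψ : ℝ → ℝ, ContDiff ℝ ∞ ψ ∧ (∀ t, φ t = φ 0 + t * ψ t) ∧ ψ 0 = deriv φ 0 := by
  obtain ⟨L, hL, h, hd⟩ := hadamard hφ (c := fun _ => 0) contDiff_const
  refine ⟨fun z => L z 1, hL.clm_apply contDiff_const, fun z => ?_, by simp [hd 0 rfl]⟩
  have hz : z - 0 = z • (1 : ℝ) := by simp
  have := h z
  rw [hz, map_smul, smul_eq_mul] at this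
  linarith

/-- This justifies cancelling a factor whose zero set has dense complement. -/
theorem eventuallyEq_of_dense {X : Type*} [TopologicalSpace X] {V : Set X} (hV : Dense V)
    {f g : X → ℝ} (hf : Continuous f) (hg : Continuous g) {p : X}
    (h : ∀ᶠ q in 𝓝 p, q ∈ V → f q = g q) : ∀ᶠ q in 𝓝 p, f q = g q := by
  obtain ⟨U, hU, hUo, hp⟩ := eventually_nhds_iff.1 h
  refine eventually_nhds_iff.2 ⟨U, fun q hq => ?_, hUo, hp⟩
  have h1 : closure (U ∩ V) ⊆ {q | f q = g q} :=
    closure_minimal (fun q hq => hU q hq.1 hq.2) (isClosed_eq hf hg)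
  exact h1 (hV.open_subset_closure_inter hUo hq)

/-- Multiplying by a bump function supported in `U` gives every smooth germ a global representative.
-/
theorem exists_contDiff_eventuallyEq {E : Type} [NormedAddCommGroup E] [NormedSpace ℝ E]
    [FiniteDimensional ℝ E] {U : Set E} {x : E} (hU : U ∈ 𝓝 x) {h : E → ℝ}
    (hh : ContDiffOn ℝ ∞ h U) : ∃ H : E → ℝ, ContDiff ℝ ∞ H ∧ H =ᶠ[𝓝 x] h := by
  obtain ⟨r, hr, hrU⟩ := Metric.mem_nhds_iff.1 hU
  let b : ContDiffBump x := ⟨r / 3, r / 2, by positivity, by linarith⟩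
  refine ⟨fun y => b y * h y, contDiff_iff_contDiffAt.2 fun y => ?_, ?_⟩
  · by_cases hy : y ∈ Metric.ball x r
    · exact b.contDiff.contDiffAt.mul ((hh.mono hrU).contDiffAt (Metric.isOpen_ball.mem_nhds hy))
    · have hy' : y ∉ tsupport b := by
        rw [b.tsupport_eq]
        intro hc
        have hc' : dist y x ≤ r / 2 := hc
        exact hy (Metric.mem_ball.2 (by linarith))
      refine (contDiffAt_const (c := (0 : ℝ))).congr_of_eventuallyEq ?_
      filter_upwards [(isClosed_tsupport b).isOpen_compl.mem_nhds hy'] with z hz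
      rw [image_eq_zero_of_notMem_tsupport hz, zero_mul]
  · filter_upwards [b.eventuallyEq_one] with y hy
    rw [hy, Pi.one_apply, one_mul]

theorem exists_contDiff_inv {E : Type} [NormedAddCommGroup E] [NormedSpace ℝ E]
    [FiniteDimensional ℝ E] {x : E} {f : E → ℝ} (hf : ContDiff ℝ ∞ f) (hx : f x ≠ 0) :
    ∃ g : E → ℝ, ContDiff ℝ ∞ g ∧ ∀ᶠ y in 𝓝 x, f y * g y = 1 := by
  have hU : ∀ᶠ y in 𝓝 x, f y ≠ 0 := hf.continuous.continuousAt.eventually_ne hx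
  obtain ⟨g, hg, hgf⟩ := exists_contDiff_eventuallyEq (h := fun y => (f y)⁻¹) hU
    (hf.contDiffOn.inv fun y hy => hy)
  refine ⟨g, hg, ?_⟩
  filter_upwards [hU, hgf] with y hy hy'
  rw [hy', mul_inv_cancel₀ hy]

theorem eventuallyEq_of_mul_eq {f g : ℝ → ℝ} (hf : Continuous f) (hg : Continuous g)
    (h : ∀ᶠ t in 𝓝 (0 : ℝ), t * f t = t * g t) : ∀ᶠ t in 𝓝 (0 : ℝ), f t = g t := by
  refine eventuallyEq_of_dense (dense_compl_singleton (0 : ℝ)) hf hg ?_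
  filter_upwards [h] with t ht ht0
  exact mul_left_cancel₀ ht0 ht

/-- Among two smooth germs on the line whose ideal contains a power of the coordinate, one divides
the other. -/
theorem germ_dvd_or_dvd (m : ℕ) : ∀ {φ₁ φ₂ A B u : ℝ → ℝ}, ContDiff ℝ ∞ φ₁ → ContDiff ℝ ∞ φ₂ →
    Continuous A → Continuous B → Continuous u → u 0 ≠ 0 →
    (∀ᶠ t in 𝓝 (0 : ℝ), φ₁ t * A t - φ₂ t * B t = t ^ m * u t) →
    (∃ c : ℝ → ℝ, ContDiff ℝ ∞ c ∧ ∀ᶠ t in 𝓝 (0 : ℝ), φ₂ t = c t * φ₁ t) ∨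
      ∃ c : ℝ → ℝ, ContDiff ℝ ∞ c ∧ ∀ᶠ t in 𝓝 (0 : ℝ), φ₁ t = c t * φ₂ t := by
  have unit : ∀ {φ₁ φ₂ : ℝ → ℝ}, ContDiff ℝ ∞ φ₁ → ContDiff ℝ ∞ φ₂ → φ₁ 0 ≠ 0 →
      ∃ c : ℝ → ℝ, ContDiff ℝ ∞ c ∧ ∀ᶠ t in 𝓝 (0 : ℝ), φ₂ t = c t * φ₁ t := by
    intro φ₁ φ₂ h₁ h₂ h0
    obtain ⟨g, hg, hg1⟩ := exists_contDiff_inv h₁ h0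
    refine ⟨fun t => φ₂ t * g t, h₂.mul hg, ?_⟩
    filter_upwards [hg1] with t ht
    linear_combination -φ₂ t * ht
  induction m with
  | zero =>
    intro φ₁ φ₂ A B u h₁ h₂ hA hB hu hu0 h
    have h0 := h.self_of_nhds
    -- At `t = 0` the relation reads `φ₁ A - φ₂ B = u 0 ≠ 0`, so one of the two germs is a unit and
    -- divides the other.
    by_cases h₁0 : φ₁ 0 = 0
    · refine Or.inr (unit h₂ h₁ fun h₂0 => hu0 ?_)
      simpa [h₁0, h₂0] using h0.symm
    · exact Or.inl (unit h₁ h₂ h₁0)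
  | succ m ih =>
    intro φ₁ φ₂ A B u h₁ h₂ hA hB hu hu0 h
    by_cases h₁0 : φ₁ 0 = 0
    · by_cases h₂0 : φ₂ 0 = 0
      -- When both germs vanish at `0`, dividing both by `t` lowers the exponent `m` by one.
      · obtain ⟨ψ₁, hψ₁, e₁, -⟩ := hadamard_line h₁
        obtain ⟨ψ₂, hψ₂, e₂, -⟩ := hadamard_line h₂
        have key : ∀ᶠ t in 𝓝 (0 : ℝ), ψ₁ t * A t - ψ₂ t * B t = t ^ m * u t := by
          refine eventuallyEq_of_mul_eq
            ((hψ₁.continuous.mul hA).sub (hψ₂.continuous.mul hB)) (by fun_prop) ?_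
          filter_upwards [h] with t ht
          rw [e₁ t, e₂ t, h₁0, h₂0] at ht
          linear_combination ht
        rcases ih hψ₁ hψ₂ hA hB hu hu0 key with ⟨c, hc, h⟩ | ⟨c, hc, h⟩
        · refine Or.inl ⟨c, hc, ?_⟩
          filter_upwards [h] with t ht
          rw [e₁ t, e₂ t, h₁0, h₂0, ht]
          ring
        · refine Or.inr ⟨c, hc, ?_⟩
          filter_upwards [h] with t ht
          rw [e₁ t, e₂ t, h₁0, h₂0, ht]
          ring
      · exact Or.inr (unit h₂ h₁ h₂0)
    · exact Or.inl (unit h₁ h₂ h₁0)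

/-- The inverse function theorem in the plane: near a point where the Jacobian of `(X, Y)` does not
vanish, every smooth function is a smooth function of `X` and `Y`. -/
theorem plane_change_of_coordinates {X Y : ℝ × ℝ → ℝ} (hX : ContDiff ℝ ∞ X) (hY : ContDiff ℝ ∞ Y)
    {z₀ : ℝ × ℝ} (hJ : fderiv ℝ X z₀ (1, 0) * fderiv ℝ Y z₀ (0, 1)
      - fderiv ℝ X z₀ (0, 1) * fderiv ℝ Y z₀ (1, 0) ≠ 0) :
    map (fun z => (X z, Y z)) (𝓝 z₀) = 𝓝 (X z₀, Y z₀) ∧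
      ∀ H : ℝ × ℝ → ℝ, ContDiff ℝ ∞ H → ∃ K : ℝ × ℝ → ℝ, ContDiff ℝ ∞ K ∧
        ∀ᶠ z in 𝓝 z₀, H z = K (X z, Y z) := by
  have hΦ : ContDiff ℝ ∞ fun z => (X z, Y z) := hX.prodMk hY
  set Φ : ℝ × ℝ → ℝ × ℝ := fun z => (X z, Y z) with hΦdef
  let J : ℝ × ℝ → ℝ := fun z => fderiv ℝ X z (1, 0) * fderiv ℝ Y z (0, 1)
      - fderiv ℝ X z (0, 1) * fderiv ℝ Y z (1, 0)
  have hJc : Continuous J := by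
    have hx := hX.continuous_fderiv (by simp)
    have hy := hY.continuous_fderiv (by simp)
    fun_prop
  -- Invertibility is needed at all points with `J ≠ 0`, not only at `z₀`, to make the local inverse
  -- smooth on a neighbourhood.
  have hder : ∀ z, J z ≠ 0 → ∃ e : (ℝ × ℝ) ≃L[ℝ] (ℝ × ℝ),
      HasFDerivAt Φ (e : ℝ × ℝ →L[ℝ] ℝ × ℝ) z := by
    intro z hz
    have hd : HasFDerivAt Φ ((fderiv ℝ X z).prod (fderiv ℝ Y z)) z :=
      (hX.differentiable (by simp) z).hasFDerivAt.prodMk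
        (hY.differentiable (by simp) z).hasFDerivAt
    have hinj : Function.Injective ((fderiv ℝ X z).prod (fderiv ℝ Y z)).toLinearMap := by
      rw [← LinearMap.ker_eq_bot, LinearMap.ker_eq_bot']
      intro v hv
      have hv' : v = v.1 • ((1, 0) : ℝ × ℝ) + v.2 • ((0, 1) : ℝ × ℝ) := by ext <;> simp
      have e1 : fderiv ℝ X z v = 0 := congrArg Prod.fst hv
      have e2 : fderiv ℝ Y z v = 0 := congrArg Prod.snd hv
      rw [hv', map_add, map_smul, map_smul, smul_eq_mul, smul_eq_mul] at e1 e2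
      have a1 : v.1 * J z = 0 := by
        simp only [J]
        linear_combination fderiv ℝ Y z (0, 1) * e1 - fderiv ℝ X z (0, 1) * e2
      have a2 : v.2 * J z = 0 := by
        simp only [J]
        linear_combination fderiv ℝ X z (1, 0) * e2 - fderiv ℝ Y z (1, 0) * e1
      ext
      · simpa [hz] using a1
      · simpa [hz] using a2
    refine ⟨(LinearEquiv.ofInjectiveEndo _ hinj).toContinuousLinearEquiv, ?_⟩
    convert hd using 1
    ext <;> rfl
  obtain ⟨e₀, he₀⟩ := hder z₀ hJ
  have hs : HasStrictFDerivAt Φ (e₀ : ℝ × ℝ →L[ℝ] ℝ × ℝ) z₀ :=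
    hΦ.contDiffAt.hasStrictFDerivAt' he₀ (by simp)
  refine ⟨hs.map_nhds_eq_of_equiv, fun H hH => ?_⟩
  let P := hs.toOpenPartialHomeomorph Φ
  have hPΦ : ∀ z, P z = Φ z := fun z => rfl
  have hz₀ : z₀ ∈ P.source := hs.mem_toOpenPartialHomeomorph_source
  have hsm : ContDiffOn ℝ ∞ (fun w => H (P.symm w))
      (P.target ∩ P.symm ⁻¹' {z | J z ≠ 0}) := by
    rintro w ⟨hw, hwJ⟩
    obtain ⟨e, he⟩ := hder _ hwJ
    exact (hH.contDiffAt.comp w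
      (P.contDiffAt_symm hw (f₀' := e) he hΦ.contDiffAt)).contDiffWithinAt
  have hnhds : P.target ∩ P.symm ⁻¹' {z | J z ≠ 0} ∈ 𝓝 (Φ z₀) := by
    refine (P.isOpen_inter_preimage_symm (isOpen_ne_fun hJc continuous_const)).mem_nhds
      ⟨P.map_source hz₀, ?_⟩
    have : P.symm (Φ z₀) = z₀ := P.left_inv hz₀
    simpa [this] using hJ
  obtain ⟨K, hK, hKH⟩ := exists_contDiff_eventuallyEq hnhds hsm
  refine ⟨K, hK, ?_⟩
  filter_upwards [hΦ.continuous.continuousAt.eventually hKH, P.open_source.mem_nhds hz₀]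
    with z hz hzs
  have : P.symm (Φ z) = z := P.left_inv hzs
  have hz' : K (Φ z) = H (P.symm (Φ z)) := hz
  rw [this] at hz'
  exact hz'.symm

end Calculus

/-! ### Coordinate systems, locality of derivations, Cramer's rule and division by a coordinate. -/

section Germs

variable {S : Type*} [TopologicalSpace S] [ChartedSpace (EuclideanSpace ℝ (Fin 2)) S]

theorem smooth_continuous (f : Smooth S) : Continuous f := f.contMDiff.continuous

/-- A smooth function of two smooth functions. -/
noncomputable def comp₂ (H : ℝ × ℝ → ℝ) (hH : ContDiff ℝ ∞ H) (x y : Smooth S) : Smooth S :=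
  ⟨fun q => H (x q, y q), hH.contMDiff.comp (x.contMDiff.prodMk_space y.contMDiff)⟩

/-- The chain rule for vector fields. -/
theorem vField_comp₂ (X : VField (Smooth S)) {H : ℝ × ℝ → ℝ} (hH : ContDiff ℝ ∞ H)
    (x y : Smooth S) (q : S) :
    X (comp₂ H hH x y) q = fderiv ℝ H (x q, y q) (1, 0) * X x q
      + fderiv ℝ H (x q, y q) (0, 1) * X y q := by
  obtain ⟨H₁, H₂, h₁, h₂, h, e₁, e₂⟩ := hadamard_point hH (x q, y q)
  -- After applying `X` by Leibniz and evaluating at `q`, the factors `x - x q` and `y - y q`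
  -- vanish, and only the Hadamard coefficients at `q` remain.
  have key : comp₂ H hH x y = algebraMap ℝ (Smooth S) (H (x q, y q))
      + (x - algebraMap ℝ (Smooth S) (x q)) * comp₂ H₁ h₁ x y
      + (y - algebraMap ℝ (Smooth S) (y q)) * comp₂ H₂ h₂ x y := by
    ext r
    exact h (x r, y r)
  rw [key, ← e₁, ← e₂]
  simp only [map_add, Derivation.leibniz, map_sub, Derivation.map_algebraMap, zero_add, sub_zero,
    smul_eq_mul]
  change (x q - x q) * X (comp₂ H₁ h₁ x y) q + H₁ (x q, y q) * X x q
    + ((y q - y q) * X (comp₂ H₂ h₂ x y) q + H₂ (x q, y q) * X y q) = _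
  ring

/-- The determinant of two vector fields with respect to the frame dual to `dx`, `dy`. -/
noncomputable def jac (x y : Smooth S) (X Y : VField (Smooth S)) : Smooth S := X x * Y y - X y * Y x

theorem jac_apply (x y : Smooth S) (X Y : VField (Smooth S)) (q : S) :
    jac x y X Y q = X x q * Y y q - X y q * Y x q := rfl

theorem jac_add (x y : Smooth S) (X Y Z : VField (Smooth S)) :
    jac x y X (Y + Z) = jac x y X Y + jac x y X Z := by
  simp only [jac, Derivation.add_apply]
  ring

theorem jac_smul (x y f : Smooth S) (X Y : VField (Smooth S)) :
    jac x y X (f • Y) = f * jac x y X Y := by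
  simp only [jac, Derivation.smul_apply, smul_eq_mul]
  ring

/-- The functions `x`, `y` form a coordinate system near `p`. -/
def IsCoord (x y : Smooth S) (p : S) : Prop := ∃ X Y : VField (Smooth S), jac x y X Y p ≠ 0

theorem IsCoord.eventually {x y : Smooth S} {p : S} (h : IsCoord x y p) :
    ∀ᶠ q in 𝓝 p, IsCoord x y q := by
  obtain ⟨X, Y, hXY⟩ := h
  filter_upwards [(smooth_continuous (jac x y X Y)).continuousAt.eventually_ne hXY] with q hq
  exact ⟨X, Y, hq⟩

theorem exists_smooth_inv {p : S} {f : Smooth S} (hf : f p ≠ 0) :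
    ∃ g : Smooth S, ∀ᶠ q in 𝓝 p, f q * g q = 1 := by
  obtain ⟨g, hg, hgf⟩ := exists_contDiff_inv (E := ℝ) contDiff_id hf
  exact ⟨⟨fun q => g (f q), hg.contMDiff.comp f.contMDiff⟩,
    (smooth_continuous f).continuousAt.eventually hgf⟩

/-- The bump vanishes near each point outside `U`, not just at it, so objects cut off by it have
zero germ there. -/
theorem exists_bump [T2Space S] [IsManifold (𝓡 2) ∞ S] {p : S} {U : Set S} (hU : U ∈ 𝓝 p) :
    ∃ g : Smooth S, (∀ᶠ q in 𝓝 p, g q = 1) ∧ ∀ q, q ∉ U → ∀ᶠ r in 𝓝 q, g r = 0 := by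
  obtain ⟨g, -, hg⟩ := (SmoothBumpFunction.nhds_basis_tsupport (I := 𝓡 2) p).mem_iff.1 hU
  refine ⟨⟨g, g.contMDiff⟩, g.eventuallyEq_one, fun q hq => ?_⟩
  filter_upwards [(isClosed_tsupport g).isOpen_compl.mem_nhds fun h => hq (hg h)] with r hr
  exact image_eq_zero_of_notMem_tsupport hr

variable [T2Space S] [IsManifold (𝓡 2) ∞ S]

/-- Vector fields are local operators. -/
theorem vField_congr (X : VField (Smooth S)) {f h : Smooth S} {p : S}
    (hfh : ∀ᶠ q in 𝓝 p, f q = h q) : ∀ᶠ q in 𝓝 p, X f q = X h q := by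
  refine hfh.eventually_nhds.mono fun q hq => ?_
  obtain ⟨g, hg1, hg0⟩ := exists_bump hq
  -- A bump supported where `f = h` makes the product vanish identically; Leibniz at `q`, where `g =
  -- 1` and `f = h`, then gives the claim.
  have h0 : g * (f - h) = 0 := by
    ext r
    change g r * (f r - h r) = 0
    by_cases hr : f r = h r
    · rw [hr, sub_self, mul_zero]
    · rw [(hg0 r hr).self_of_nhds, zero_mul]
  have h1 : X (g * (f - h)) q = 0 := by rw [h0, map_zero]; rfl
  rw [Derivation.leibniz, map_sub] at h1
  change g q * (X f q - X h q) + (f q - h q) * X g q = 0 at h1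
  rw [hg1.self_of_nhds, hq.self_of_nhds] at h1
  linarith

/-- The field is the constant field `v` of the chart at `p`, multiplied by a bump function. -/
theorem exists_vField (p : S) (v : EuclideanSpace ℝ (Fin 2)) :
    ∃ X : VField (Smooth S), ∀ f : Smooth S,
      X f p = fderiv ℝ (f ∘ (chartAt (EuclideanSpace ℝ (Fin 2)) p).symm) (chartAt _ p p) v := by
  set φ := chartAt (EuclideanSpace ℝ (Fin 2)) p with hφ
  let g : SmoothBumpFunction (𝓡 2) p := Classical.arbitrary _
  have hf (f : Smooth S) : ContDiffOn ℝ ∞ (f ∘ φ.symm) φ.target :=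
    contMDiffOn_iff_contDiffOn.1 (f.contMDiff.comp_contMDiffOn (contMDiffOn_chart_symm (x := p)))
  have hd (f : Smooth S) {q : S} (hq : q ∈ φ.source) :
      DifferentiableAt ℝ (f ∘ φ.symm) (φ q) :=
    ((hf f).contDiffAt (φ.open_target.mem_nhds (φ.map_source hq))).differentiableAt (by simp)
  have hs (f : Smooth S) : ContMDiff (𝓡 2) 𝓘(ℝ, ℝ) ∞
      fun q => g q • fderiv ℝ (f ∘ φ.symm) (φ q) v := by
    refine g.contMDiff_smul ?_
    have h1 : ContDiffOn ℝ ∞ (fun z => fderiv ℝ (f ∘ φ.symm) z v) φ.target :=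
      ((hf f).fderiv_of_isOpen φ.open_target (by simp)).clm_apply contDiffOn_const
    exact h1.contMDiffOn.comp (contMDiffOn_chart (x := p)) fun q hq => φ.map_source hq
  have hg0 {q : S} (hq : q ∉ φ.source) : g q = 0 := by
    by_contra h
    exact hq (g.support_subset_source h)
  refine ⟨Derivation.mk'
    { toFun := fun f => ⟨_, hs f⟩
      map_add' := fun f h => ?_
      map_smul' := fun c f => ?_ } fun f h => ?_, fun f => ?_⟩
  · ext q
    change g q • fderiv ℝ (f ∘ φ.symm + h ∘ φ.symm) (φ q) v
      = g q • fderiv ℝ (f ∘ φ.symm) (φ q) v + g q • fderiv ℝ (h ∘ φ.symm) (φ q) v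
    by_cases hq : q ∈ φ.source
    · rw [fderiv_add (hd f hq) (hd h hq), add_apply, smul_add]
    · simp [hg0 hq]
  · ext q
    change g q • fderiv ℝ (c • (f ∘ φ.symm)) (φ q) v = c • g q • fderiv ℝ (f ∘ φ.symm) (φ q) v
    by_cases hq : q ∈ φ.source
    · rw [fderiv_const_smul (hd f hq), smul_apply, smul_comm]
    · simp [hg0 hq]
  · ext q
    change g q • fderiv ℝ ((f ∘ φ.symm) * (h ∘ φ.symm)) (φ q) v
      = f q * (g q • fderiv ℝ (h ∘ φ.symm) (φ q) v) + h q * (g q • fderiv ℝ (f ∘ φ.symm) (φ q) v)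
    by_cases hq : q ∈ φ.source
    · rw [fderiv_mul (hd f hq) (hd h hq)]
      simp only [Function.comp_apply, φ.left_inv hq, add_apply,
        smul_apply, smul_eq_mul]
      ring
    · simp [hg0 hq]
  · change g p • fderiv ℝ (f ∘ φ.symm) (φ p) v = _
    rw [g.eq_one, one_smul]

/-- The coordinates of a chart, cut off to global functions. -/
theorem exists_chart_coord_frame (p : S) : ∃ x y : Smooth S,
    (∃ X Y : VField (Smooth S), jac x y X Y p ≠ 0 ∧
      (∃ v, ∀ f : Smooth S, X f p =
        fderiv ℝ (f ∘ (chartAt (EuclideanSpace ℝ (Fin 2)) p).symm) (chartAt _ p p) v) ∧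
      ∃ v, ∀ f : Smooth S, Y f p =
        fderiv ℝ (f ∘ (chartAt (EuclideanSpace ℝ (Fin 2)) p).symm) (chartAt _ p p) v) ∧
    map (fun q => (x q, y q)) (𝓝 p) = 𝓝 (x p, y p) ∧
    ∀ f : Smooth S, ∃ H : ℝ × ℝ → ℝ, ContDiff ℝ ∞ H ∧ ∀ᶠ q in 𝓝 p, f q = H (x q, y q) := by
  set φ := chartAt (EuclideanSpace ℝ (Fin 2)) p with hφ
  have hp : p ∈ φ.source := mem_chart_source _ p
  let g : SmoothBumpFunction (𝓡 2) p := Classical.arbitrary _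
  have hs (i : Fin 2) : ContMDiff (𝓡 2) 𝓘(ℝ, ℝ) ∞ fun q => g q • φ q i := by
    refine g.contMDiff_smul ?_
    have h1 : ContDiff ℝ ∞ fun z : EuclideanSpace ℝ (Fin 2) => z i := by fun_prop
    exact h1.contMDiff.comp_contMDiffOn (contMDiffOn_chart (x := p))
  let c (i : Fin 2) : Smooth S := ⟨_, hs i⟩
  have hc (i : Fin 2) : ∀ᶠ q in 𝓝 p, c i q = φ q i := by
    filter_upwards [g.eventuallyEq_one] with q hq
    change g q • φ q i = _
    rw [hq, Pi.one_apply, one_smul]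
  let L : EuclideanSpace ℝ (Fin 2) ≃L[ℝ] ℝ × ℝ :=
    (EuclideanSpace.equiv (Fin 2) ℝ).trans (ContinuousLinearEquiv.finTwoArrow ℝ ℝ)
  have hL : ∀ z, L z = (z 0, z 1) := fun z => rfl
  have hcL : (fun q => (c 0 q, c 1 q)) =ᶠ[𝓝 p] L ∘ φ := by
    filter_upwards [hc 0, hc 1] with q h0 h1
    rw [h0, h1]
    rfl
  have hcp : (c 0 p, c 1 p) = L (φ p) := hcL.self_of_nhds
  refine ⟨c 0, c 1, ?_, ?_, fun f => ?_⟩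
  · obtain ⟨X, hX⟩ := exists_vField p (EuclideanSpace.single (0 : Fin 2) (1 : ℝ))
    obtain ⟨Y, hY⟩ := exists_vField p (EuclideanSpace.single (1 : Fin 2) (1 : ℝ))
    refine ⟨X, Y, ?_, ⟨_, hX⟩, ⟨_, hY⟩⟩
    have hfd (i : Fin 2) : fderiv ℝ (c i ∘ φ.symm) (φ p) = EuclideanSpace.proj i := by
      have h1 : c i ∘ φ.symm =ᶠ[𝓝 (φ p)] fun z => EuclideanSpace.proj (𝕜 := ℝ) i z := by
        have ht : Tendsto φ.symm (𝓝 (φ p)) (𝓝 p) := by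
          have := φ.continuousAt_symm (φ.map_source hp)
          rwa [ContinuousAt, φ.left_inv hp] at this
        filter_upwards [ht.eventually (hc i), φ.open_target.mem_nhds (φ.map_source hp)]
          with z hz hzt
        rw [Function.comp_apply, hz, φ.right_inv hzt]
        rfl
      rw [h1.fderiv_eq]
      exact ContinuousLinearMap.fderiv _
    rw [jac_apply, hX, hX, hY, hY, hfd, hfd]
    simp
  · rw [Filter.map_congr hcL, hcp, ← Filter.map_map, φ.map_nhds_eq hp]
    exact L.toHomeomorph.map_nhds_eq _
  · have hf : ContDiffOn ℝ ∞ (f ∘ φ.symm) φ.target :=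
      contMDiffOn_iff_contDiffOn.1
        (f.contMDiff.comp_contMDiffOn (contMDiffOn_chart_symm (x := p)))
    have hU : L.symm ⁻¹' φ.target ∈ 𝓝 (c 0 p, c 1 p) := by
      rw [hcp]
      refine (φ.open_target.preimage L.symm.continuous).mem_nhds ?_
      simpa using φ.map_source hp
    obtain ⟨H, hH, hHf⟩ := exists_contDiff_eventuallyEq hU
      (h := (f ∘ φ.symm) ∘ L.symm) (hf.comp L.symm.contDiff.contDiffOn fun z hz => hz)
    refine ⟨H, hH, ?_⟩
    have ht : Tendsto (fun q => (c 0 q, c 1 q)) (𝓝 p) (𝓝 (c 0 p, c 1 p)) :=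
      ((smooth_continuous (c 0)).prodMk (smooth_continuous (c 1))).continuousAt
    filter_upwards [ht.eventually hHf, hcL, φ.open_source.mem_nhds hp] with q hq hq' hqs
    rw [hq, hq']
    simp [φ.left_inv hqs]

theorem exists_chart_coord (p : S) : ∃ x y : Smooth S, IsCoord x y p ∧
    map (fun q => (x q, y q)) (𝓝 p) = 𝓝 (x p, y p) ∧
    ∀ f : Smooth S, ∃ H : ℝ × ℝ → ℝ, ContDiff ℝ ∞ H ∧ ∀ᶠ q in 𝓝 p, f q = H (x q, y q) := by
  obtain ⟨x, y, ⟨X, Y, h, -⟩, h'⟩ := exists_chart_coord_frame p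
  exact ⟨x, y, ⟨X, Y, h⟩, h'⟩

variable {x y : Smooth S} {p : S}

/-- In chart coordinates `a`, `b` the chain rule factors `jac x y` through the Jacobian of `(x, y)`
with respect to `(a, b)`. That Jacobian is therefore nonzero at `p`, and the inverse function
theorem applies. -/
theorem IsCoord.map_nhds_and_exists_rep (h : IsCoord x y p) :
    map (fun q => (x q, y q)) (𝓝 p) = 𝓝 (x p, y p) ∧
    ∀ f : Smooth S, ∃ H : ℝ × ℝ → ℝ, ContDiff ℝ ∞ H ∧ ∀ᶠ q in 𝓝 p, f q = H (x q, y q) := by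
  obtain ⟨a, b, -, hmap, hrep⟩ := exists_chart_coord p
  obtain ⟨A, hA, hxA⟩ := hrep x
  obtain ⟨B, hB, hyB⟩ := hrep y
  obtain ⟨X, Y, hXY⟩ := h
  have ex (W : VField (Smooth S)) : W x p = fderiv ℝ A (a p, b p) (1, 0) * W a p
      + fderiv ℝ A (a p, b p) (0, 1) * W b p := by
    rw [(vField_congr W (h := comp₂ A hA a b) hxA).self_of_nhds, vField_comp₂]
  have ey (W : VField (Smooth S)) : W y p = fderiv ℝ B (a p, b p) (1, 0) * W a p
      + fderiv ℝ B (a p, b p) (0, 1) * W b p := by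
    rw [(vField_congr W (h := comp₂ B hB a b) hyB).self_of_nhds, vField_comp₂]
  have hJ : fderiv ℝ A (a p, b p) (1, 0) * fderiv ℝ B (a p, b p) (0, 1)
      - fderiv ℝ A (a p, b p) (0, 1) * fderiv ℝ B (a p, b p) (1, 0) ≠ 0 := by
    intro h0
    apply hXY
    rw [jac_apply, ex, ex, ey, ey]
    linear_combination (X a p * Y b p - X b p * Y a p) * h0
  obtain ⟨hm, hr⟩ := plane_change_of_coordinates hA hB hJ
  have hxy : (fun q => (x q, y q)) =ᶠ[𝓝 p] (fun z => (A z, B z)) ∘ fun q => (a q, b q) := by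
    filter_upwards [hxA, hyB] with q h1 h2
    simp only [Function.comp_apply, h1, h2]
  have hxyp : (x p, y p) = (A (a p, b p), B (a p, b p)) := hxy.self_of_nhds
  refine ⟨?_, fun f => ?_⟩
  · rw [Filter.map_congr hxy, ← Filter.map_map, hmap, hm, hxyp]
  · obtain ⟨H, hH, hfH⟩ := hrep f
    obtain ⟨K, hK, hHK⟩ := hr H hH
    refine ⟨K, hK, ?_⟩
    rw [← hmap] at hHK
    filter_upwards [hfH, hHK, hxy] with q h1 h2 h3
    rw [h1, h2, h3]
    rfl

theorem IsCoord.eventually_iff (h : IsCoord x y p) {P : ℝ × ℝ → Prop} :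
    (∀ᶠ q in 𝓝 p, P (x q, y q)) ↔ ∀ᶠ z in 𝓝 (x p, y p), P z := by
  rw [← h.map_nhds_and_exists_rep.1, eventually_map]

theorem IsCoord.exists_rep (h : IsCoord x y p) (f : Smooth S) :
    ∃ H : ℝ × ℝ → ℝ, ContDiff ℝ ∞ H ∧ ∀ᶠ q in 𝓝 p, f q = H (x q, y q) :=
  h.map_nhds_and_exists_rep.2 f

/-- The partial derivatives of a function with respect to a coordinate system. -/
theorem IsCoord.exists_partial (h : IsCoord x y p) (f : Smooth S) :
    ∃ f₁ f₂ : Smooth S, ∀ X : VField (Smooth S),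
      ∀ᶠ q in 𝓝 p, X f q = f₁ q * X x q + f₂ q * X y q := by
  obtain ⟨H, hH, hf⟩ := h.exists_rep f
  have hd (v : ℝ × ℝ) : ContDiff ℝ ∞ fun z => fderiv ℝ H z v :=
    (hH.fderiv_right (m := ∞) (by simp)).clm_apply contDiff_const
  refine ⟨comp₂ _ (hd (1, 0)) x y, comp₂ _ (hd (0, 1)) x y, fun X => ?_⟩
  filter_upwards [vField_congr X (h := comp₂ H hH x y) hf] with q hq
  rw [hq, vField_comp₂]
  rfl

/-- Cramer's rule: the relation between three vector fields on a surface. -/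
theorem IsCoord.exists_cramer (h : IsCoord x y p) : ∃ g : Smooth S, (∀ᶠ q in 𝓝 p, g q = 1) ∧
    ∀ e₁ e₂ u : VField (Smooth S), (g * jac x y e₁ e₂) • u
      = (g * jac x y u e₂) • e₁ + (g * jac x y e₁ u) • e₂ := by
  obtain ⟨g, hg1, hg0⟩ := exists_bump h.eventually
  refine ⟨g, hg1, fun e₁ e₂ u => Derivation.ext fun f => ?_⟩
  ext q
  change g q * jac x y e₁ e₂ q * u f q
    = g q * jac x y u e₂ q * e₁ f q + g q * jac x y e₁ u q * e₂ f q
  -- Where `x`, `y` are coordinates this is the pointwise Cramer identity; elsewhere `g` vanishes.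
  -- The relation is thus global and can be fed to `Smooth S`-linear maps.
  by_cases hq : IsCoord x y q
  · obtain ⟨f₁, f₂, hf⟩ := hq.exists_partial f
    rw [(hf u).self_of_nhds, (hf e₁).self_of_nhds, (hf e₂).self_of_nhds]
    simp only [jac_apply]
    ring
  · rw [(hg0 q hq).self_of_nhds]
    ring

theorem IsCoord.vField_apply_eq_zero (h : IsCoord x y p) {X : VField (Smooth S)}
    (hx : X x p = 0) (hy : X y p = 0) (f : Smooth S) : X f p = 0 := by
  obtain ⟨f₁, f₂, hf⟩ := h.exists_partial f
  rw [(hf X).self_of_nhds, hx, hy, mul_zero, mul_zero, add_zero]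

/-- Division by a coordinate. -/
theorem IsCoord.exists_eq_mul (h : IsCoord x y p) (hp : x p = 0) {f : Smooth S}
    (hf : ∀ᶠ q in 𝓝 p, x q = 0 → f q = 0) :
    ∃ f' : Smooth S, ∀ᶠ q in 𝓝 p, f q = x q * f' q := by
  obtain ⟨H, hH, hfH⟩ := h.exists_rep f
  obtain ⟨H₁, hH₁, e⟩ := hadamard_fst hH
  refine ⟨comp₂ H₁ hH₁ x y, ?_⟩
  have h0 : ∀ᶠ z in 𝓝 (x p, y p), z.1 = 0 → H z = 0 := by
    rw [← h.eventually_iff]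
    filter_upwards [hfH, hf] with q h1 h2 h3
    rw [← h1, h2 h3]
  -- Since `x p = 0`, projecting onto the axis fixes the base point, so points near it stay in the
  -- neighbourhood where the vanishing of `H` is known.
  have ht : Tendsto (fun z : ℝ × ℝ => (0, z.2)) (𝓝 (x p, y p)) (𝓝 (x p, y p)) := by
    have : ContinuousAt (fun z : ℝ × ℝ => ((0 : ℝ), z.2)) (x p, y p) := by fun_prop
    simpa [ContinuousAt, hp] using this
  have h1 : ∀ᶠ q in 𝓝 p, H (0, y q) = 0 :=
    (h.eventually_iff (P := fun z => H (0, z.2) = 0)).2 ((ht.eventually h0).mono fun z hz => hz rfl)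
  filter_upwards [hfH, h1] with q h2 h3
  rw [h2, e, h3, zero_add]
  rfl

end Germs

/-! ### Defining functions, transverse families and frames of fields tangent to them. -/

section Curves

variable {S : Type*} [TopologicalSpace S] [ChartedSpace (EuclideanSpace ℝ (Fin 2)) S]

/-- `f` is a defining function, near `p`, of the curve `Z`. -/
structure IsDefining (Z : Set S) (f : Smooth S) (p : S) : Prop where
  vanish : ∀ q ∈ Z, f q = 0
  mem : ∀ᶠ q in 𝓝 p, f q = 0 → q ∈ Z
  ne_zero : ∃ X : VField (Smooth S), X f p ≠ 0

theorem IsDefining.eventually {Z : Set S} {f : Smooth S} {p : S} (h : IsDefining Z f p) :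
    ∀ᶠ q in 𝓝 p, IsDefining Z f q := by
  obtain ⟨X, hX⟩ := h.ne_zero
  filter_upwards [h.mem.eventually_nhds,
    (smooth_continuous (X f)).continuousAt.eventually_ne hX] with q h1 h2
  exact ⟨h.vanish, h1, X, h2⟩

/-- A finite family of functions that vanish at `p` and whose differentials at `p` are nonzero and
pairwise independent. -/
structure IsTransverseFamily {ι : Type*} (f : ι → Smooth S) (J : Finset ι) (p : S) : Prop where
  zero : ∀ j ∈ J, f j p = 0
  ne_zero : ∀ j ∈ J, ∃ X : VField (Smooth S), X (f j) p ≠ 0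
  coord : ∀ i ∈ J, ∀ j ∈ J, i ≠ j → IsCoord (f i) (f j) p

theorem IsTransverseFamily.mono {ι : Type*} {f : ι → Smooth S} {J K : Finset ι} {p : S}
    (h : IsTransverseFamily f K p) (hJ : J ⊆ K) : IsTransverseFamily f J p :=
  ⟨fun j hj => h.zero j (hJ hj), fun j hj => h.ne_zero j (hJ hj),
    fun i hi j hj => h.coord i (hJ hi) j (hJ hj)⟩

theorem mfderiv_eq_fderiv_chart (f : Smooth S) (p : S) :
    mfderiv (𝓡 2) 𝓘(ℝ, ℝ) f p =
      fderiv ℝ (f ∘ (chartAt (EuclideanSpace ℝ (Fin 2)) p).symm) (chartAt _ p p) := by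
  have h := (f.contMDiff.mdifferentiable (by simp) p).mfderiv
  rw [writtenInExtChartAt, extChartAt_model_space_eq_id] at h
  simp only [extChartAt, mfld_simps, fderivWithin_univ, PartialEquiv.refl_coe,
    Function.id_comp] at h
  exact h

variable [T2Space S] [IsManifold (𝓡 2) ∞ S]

/-- Every tangent vector extends to a vector field. -/
theorem exists_vField_mfderiv (p : S) (v : TangentSpace (𝓡 2) p) :
    ∃ X : VField (Smooth S), ∀ f : Smooth S, X f p = mfderiv (𝓡 2) 𝓘(ℝ, ℝ) f p v := by
  obtain ⟨X, hX⟩ := exists_vField p v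
  exact ⟨X, fun f => (hX f).trans (congrArg (· v) (mfderiv_eq_fderiv_chart f p).symm)⟩

/-- A local equation need not vanish on the distant parts of `Z`; a bump supported where it is valid
makes it vanish on all of `Z` without changing its germ at `p`. -/
theorem exists_isDefining {Z : Set S} (hZ : IsSmoothClosedCurve Z) {p : S} (hp : p ∈ Z) :
    ∃ f : Smooth S, IsDefining Z f p := by
  obtain ⟨f, hf, hZf⟩ := hZ.2 p hp
  obtain ⟨g, hg1, hg0⟩ := exists_bump hZf
  have hgf : ∀ᶠ q in 𝓝 p, (g * f) q = f q := by
    filter_upwards [hg1] with q hq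
    change g q * f q = f q
    rw [hq, one_mul]
  refine ⟨g * f, fun q hq => ?_, ?_, ?_⟩
  · change g q * f q = 0
    by_cases h : q ∈ Z ↔ f q = 0
    · rw [h.1 hq, mul_zero]
    · rw [(hg0 q h).self_of_nhds, zero_mul]
  · filter_upwards [hgf, hZf] with q h1 h2 h3
    exact h2.2 (h1 ▸ h3)
  · obtain ⟨v, hv⟩ := DFunLike.ne_iff.1 hf
    obtain ⟨X, hX⟩ := exists_vField_mfderiv p v
    refine ⟨X, ?_⟩
    rw [(vField_congr X hgf).self_of_nhds, hX]
    exact hv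

/-- If `df` and `dg` were dependent at `p`, their kernels would satisfy `ker df ≤ ker dg`. Both
tangent spaces would then lie in `ker dg`, and transversality would force `dg = 0`. -/
theorem isCoord_of_transverse {Z W : Set S} {f g : Smooth S} {p : S} (hf : IsDefining Z f p)
    (hg : IsDefining W g p) (h : tangentTo Z p ⊔ tangentTo W p = ⊤) : IsCoord f g p := by
  by_contra hc
  simp only [IsCoord, jac_apply, not_exists, not_not] at hc
  obtain ⟨X, hX⟩ := hf.ne_zero
  obtain ⟨Y, hY⟩ := hg.ne_zero
  have hker : LinearMap.ker (mfderiv (𝓡 2) 𝓘(ℝ, ℝ) f p).toLinearMap ≤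
      LinearMap.ker (mfderiv (𝓡 2) 𝓘(ℝ, ℝ) g p).toLinearMap := by
    intro v hv
    obtain ⟨V, hV⟩ := exists_vField_mfderiv p v
    have h1 : V f p = 0 := (hV f).trans hv
    have h2 := hc X V
    rw [h1, mul_zero, sub_zero] at h2
    have h3 := (mul_eq_zero.1 h2).resolve_left hX
    exact (hV g).symm.trans h3
  have htop : (⊤ : Submodule ℝ (TangentSpace (𝓡 2) p)) ≤
      LinearMap.ker (mfderiv (𝓡 2) 𝓘(ℝ, ℝ) g p).toLinearMap := by
    rw [← h]
    exact sup_le ((iInf₂_le f hf.vanish).trans hker) (iInf₂_le g hg.vanish)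
  -- The derivation `Y` is not given as a tangent vector, so `dg = 0` is first used on a chart
  -- frame, to kill the partial derivatives of `g`, and only then on `Y`.
  have hg0 (v) : fderiv ℝ (g ∘ (chartAt (EuclideanSpace ℝ (Fin 2)) p).symm)
      (chartAt _ p p) v = 0 := by
    rw [← mfderiv_eq_fderiv_chart]
    exact htop (Submodule.mem_top (x := v))
  obtain ⟨x, y, ⟨V, W, hVW, ⟨v, hv⟩, w, hw⟩, -⟩ := exists_chart_coord_frame p
  obtain ⟨g₁, g₂, hg'⟩ := IsCoord.exists_partial ⟨V, W, hVW⟩ g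
  have e₁ := (hg' V).self_of_nhds
  have e₂ := (hg' W).self_of_nhds
  rw [hv, hg0] at e₁
  rw [hw, hg0] at e₂
  rw [jac_apply] at hVW
  have a₁ : g₁ p = 0 := by
    refine (mul_eq_zero.1 ?_).resolve_left hVW
    linear_combination -W y p * e₁ + V y p * e₂
  have a₂ : g₂ p = 0 := by
    refine (mul_eq_zero.1 ?_).resolve_left hVW
    linear_combination W x p * e₁ - V x p * e₂
  apply hY
  rw [(hg' Y).self_of_nhds, a₁, a₂, zero_mul, zero_mul, add_zero]

/-- A function with nonzero differential is part of a coordinate system. -/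
theorem IsCoord.exists_coord {x y : Smooth S} {p : S} (h : IsCoord x y p) {f : Smooth S}
    (hf : ∃ X : VField (Smooth S), X f p ≠ 0) :
    ∃ t u : Smooth S, t p = 0 ∧ u p ≠ 0 ∧ IsCoord f t p ∧
      ∀ X Y : VField (Smooth S), ∀ᶠ q in 𝓝 p, jac f t X Y q = u q * jac x y X Y q := by
  obtain ⟨f₁, f₂, hp⟩ := h.exists_partial f
  obtain ⟨X, hX⟩ := hf
  obtain ⟨Y, Z, hYZ⟩ := h
  have shift (t : Smooth S) (V : VField (Smooth S)) :
      V (t - algebraMap ℝ (Smooth S) (t p)) = V t := by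
    rw [map_sub, Derivation.map_algebraMap, sub_zero]
  have key : ∃ t u : Smooth S, u p ≠ 0 ∧
      ∀ X Y : VField (Smooth S), ∀ᶠ q in 𝓝 p, jac f t X Y q = u q * jac x y X Y q := by
    -- The second coordinate is `y` if `∂f/∂x ≠ 0` at `p`, and `x` otherwise; `u` is the resulting
    -- Jacobian, `∂f/∂x` or `-∂f/∂y`.
    by_cases h₁ : f₁ p = 0
    · refine ⟨x, -f₂, ?_, fun X Y => ?_⟩
      · intro h₂
        have h₂' : f₂ p = 0 := neg_eq_zero.1 h₂
        apply hX
        rw [(hp X).self_of_nhds, h₁, h₂', zero_mul, zero_mul, add_zero]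
      · filter_upwards [hp X, hp Y] with q e₁ e₂
        change _ = -f₂ q * _
        rw [jac_apply, jac_apply, e₁, e₂]
        ring
    · refine ⟨y, f₁, h₁, fun X Y => ?_⟩
      filter_upwards [hp X, hp Y] with q e₁ e₂
      rw [jac_apply, jac_apply, e₁, e₂]
      ring
  obtain ⟨t, u, hu, htu⟩ := key
  have htu' (X Y : VField (Smooth S)) : jac f (t - algebraMap ℝ (Smooth S) (t p)) X Y
      = jac f t X Y := by
    rw [jac, jac, shift, shift]
  refine ⟨t - algebraMap ℝ (Smooth S) (t p), u, sub_self (t p), hu, ⟨Y, Z, ?_⟩, fun X Y => ?_⟩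
  · rw [htu', (htu Y Z).self_of_nhds]
    exact mul_ne_zero hu hYZ
  · rw [htu']
    exact htu X Y

theorem exists_coord {f : Smooth S} {p : S} (hf : ∃ X : VField (Smooth S), X f p ≠ 0) :
    ∃ t : Smooth S, t p = 0 ∧ IsCoord f t p := by
  obtain ⟨x, y, hxy, -⟩ := exists_chart_coord p
  obtain ⟨t, -, ht, -, h, -⟩ := hxy.exists_coord hf
  exact ⟨t, ht, h⟩

/-! ### Restriction to the curve `x = 0`, parametrised by `t`. -/

section Restriction

variable {x t : Smooth S} {p : S}

theorem IsCoord.eventually_curve_iff (h : IsCoord x t p) (hx : x p = 0) (ht : t p = 0)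
    {P : ℝ → Prop} : (∀ᶠ q in 𝓝 p, x q = 0 → P (t q)) ↔ ∀ᶠ s in 𝓝 (0 : ℝ), P s := by
  rw [h.eventually_iff (P := fun z => z.1 = 0 → P z.2), hx, ht]
  constructor
  · intro H
    have hc : Tendsto (fun s : ℝ => ((0 : ℝ), s)) (𝓝 0) (𝓝 (0, 0)) :=
      (Continuous.prodMk_right (0 : ℝ)).continuousAt
    exact (hc.eventually H).mono fun s hs => hs rfl
  · intro H
    have hc : Tendsto (fun z : ℝ × ℝ => z.2) (𝓝 (0, 0)) (𝓝 0) := continuous_snd.continuousAt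
    exact (hc.eventually H).mono fun z hz _ => hz

/-- On the curve `x = 0` every smooth function is a smooth function of the coordinate `t`. -/
theorem IsCoord.exists_restrict (h : IsCoord x t p) (f : Smooth S) :
    ∃ φ : ℝ → ℝ, ContDiff ℝ ∞ φ ∧ ∀ᶠ q in 𝓝 p, x q = 0 → f q = φ (t q) := by
  obtain ⟨H, hH, hf⟩ := h.exists_rep f
  refine ⟨fun s => H (0, s), hH.comp (contDiff_const.prodMk contDiff_id), ?_⟩
  filter_upwards [hf] with q hq hx
  rw [hq, hx]

/-- The differentials of `g` and `x` are independent at `p`, so `g` has a simple zero along the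
curve; a vanishing `t`-derivative would make `dg` a multiple of `dx`. -/
theorem IsCoord.exists_restrict_coord (h : IsCoord x t p) (hx : x p = 0) (ht : t p = 0)
    {g : Smooth S} (hg : IsCoord x g p) (hgp : g p = 0) :
    ∃ u : ℝ → ℝ, ContDiff ℝ ∞ u ∧ u 0 ≠ 0 ∧ ∀ᶠ q in 𝓝 p, x q = 0 → g q = t q * u (t q) := by
  obtain ⟨H, hH, hgH⟩ := h.exists_rep g
  have hH0 : ContDiff ℝ ∞ fun s : ℝ => H (0, s) := hH.comp (contDiff_const.prodMk contDiff_id)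
  obtain ⟨u, hu, e, hu0⟩ := hadamard_line hH0
  have h00 : H (0, 0) = 0 := by
    have := hgH.self_of_nhds
    rwa [hgp, hx, ht, eq_comm] at this
  refine ⟨u, hu, ?_, ?_⟩
  · have hd : deriv (fun s : ℝ => H (0, s)) 0 = fderiv ℝ H (0, 0) (0, 1) := by
      have h1 := (hH.differentiable (by simp) ((0 : ℝ), (0 : ℝ))).hasFDerivAt
      have h2 : HasDerivAt (fun s : ℝ => ((0 : ℝ), s)) (0, 1) 0 :=
        (hasDerivAt_const _ _).prodMk (hasDerivAt_id _)
      exact (h1.comp_hasDerivAt (0 : ℝ) h2).deriv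
    rw [hu0, hd]
    intro h0
    obtain ⟨X, Y, hXY⟩ := hg
    have eg (W : VField (Smooth S)) : W g p = fderiv ℝ H (0, 0) (1, 0) * W x p := by
      rw [(vField_congr W (h := comp₂ H hH x t) hgH).self_of_nhds, vField_comp₂, hx, ht, h0,
        zero_mul, add_zero]
    apply hXY
    rw [jac_apply, eg, eg]
    ring
  · filter_upwards [hgH] with q hq hxq
    rw [hq, hxq]
    have := e (t q)
    rwa [h00, zero_add] at this

theorem IsCoord.exists_restrict_prod (h : IsCoord x t p) (hx : x p = 0) (ht : t p = 0)
    {ι : Type*} {f : ι → Smooth S} (J : Finset ι) (hJ : ∀ j ∈ J, f j p = 0 ∧ IsCoord x (f j) p) :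
    ∃ u : ℝ → ℝ, ContDiff ℝ ∞ u ∧ u 0 ≠ 0 ∧
      ∀ᶠ q in 𝓝 p, x q = 0 → ∏ j ∈ J, f j q = t q ^ J.card * u (t q) := by
  classical
  induction J using Finset.induction_on with
  | empty => exact ⟨fun _ => 1, contDiff_const, one_ne_zero, by simp⟩
  | insert j J hj ih =>
    obtain ⟨u, hu, hu0, e⟩ := ih fun i hi => hJ i (Finset.mem_insert_of_mem hi)
    obtain ⟨hz, hc⟩ := hJ j (Finset.mem_insert_self _ _)
    obtain ⟨w, hw, hw0, e'⟩ := h.exists_restrict_coord hx ht hc hz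
    refine ⟨fun s => w s * u s, hw.mul hu, mul_ne_zero hw0 hu0, ?_⟩
    filter_upwards [e, e'] with q h1 h2 h3
    rw [Finset.prod_insert hj, Finset.card_insert_of_notMem hj, h1 h3, h2 h3]
    ring

end Restriction

variable {ι : Type*} {f : ι → Smooth S} {J : Finset ι} {p : S}

/-- Division by a product of transverse functions. -/
theorem IsTransverseFamily.exists_eq_prod_mul (h : IsTransverseFamily f J p) {d : Smooth S}
    (hd : ∀ j ∈ J, ∀ᶠ q in 𝓝 p, f j q = 0 → d q = 0) :
    ∃ d' : Smooth S, ∀ᶠ q in 𝓝 p, d q = (∏ j ∈ J, f j q) * d' q := by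
  classical
  induction J using Finset.induction_on with
  | empty => exact ⟨d, by simp⟩
  | insert j J hj ih =>
    obtain ⟨d', hd'⟩ := ih (h.mono (Finset.subset_insert _ _))
      fun i hi => hd i (Finset.mem_insert_of_mem hi)
    have hjm := Finset.mem_insert_self j J
    obtain ⟨t, ht, hc⟩ := exists_coord (h.ne_zero j hjm)
    have hz := h.zero j hjm
    obtain ⟨u, hu, hu0, e⟩ := hc.exists_restrict_prod hz ht J fun i hi =>
      ⟨h.zero i (Finset.mem_insert_of_mem hi), h.coord j hjm i (Finset.mem_insert_of_mem hi)
        (by rintro rfl; exact hj hi)⟩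
    obtain ⟨δ, hδ, e'⟩ := hc.exists_restrict d'
    -- On the curve `f j = 0` the other factors multiply to a power of `t` times a unit. So the
    -- quotient `d'` vanishes there off `t = 0`, hence everywhere by continuity, and `f j` divides
    -- it.
    have h1 : ∀ᶠ s in 𝓝 (0 : ℝ), s ^ J.card * u s * δ s = 0 := by
      rw [← hc.eventually_curve_iff hz ht]
      filter_upwards [hd', hd j hjm, e, e'] with q h1 h2 h3 h4 h5
      rw [← h3 h5, ← h4 h5, ← h1, h2 h5]
    have h2 : ∀ᶠ s in 𝓝 (0 : ℝ), δ s = 0 := by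
      refine eventuallyEq_of_dense (dense_compl_singleton (0 : ℝ)) hδ.continuous
        continuous_const ?_
      filter_upwards [h1, hu.continuous.continuousAt.eventually_ne hu0] with s h1 h2 h3
      exact (mul_eq_zero.1 h1).resolve_left (mul_ne_zero (pow_ne_zero _ h3) h2)
    rw [← hc.eventually_curve_iff hz ht] at h2
    obtain ⟨d'', hd''⟩ := hc.exists_eq_mul hz (f := d') (by
      filter_upwards [h2, e'] with q h1 h2 h3
      rw [h2 h3, h1 h3])
    refine ⟨d'', ?_⟩
    filter_upwards [hd', hd''] with q h1 h2
    rw [h1, h2, Finset.prod_insert hj]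
    ring

/-- Local freeness of the vector fields tangent to a transverse family of curves: there are two of
them whose determinant is the product of the defining functions, up to a unit. -/
theorem IsTransverseFamily.exists_frame (h : IsTransverseFamily f J p) {x y : Smooth S}
    (hxy : IsCoord x y p) :
    ∃ (e₁ e₂ : VField (Smooth S)) (c : Smooth S), c p ≠ 0 ∧
      (∀ᶠ q in 𝓝 p, jac x y e₁ e₂ q = c q * ∏ j ∈ J, f j q) ∧
      ∀ j ∈ J, ∀ᶠ q in 𝓝 p, f j q = 0 → e₁ (f j) q = 0 ∧ e₂ (f j) q = 0 := by
  classical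
  induction J using Finset.induction_on with
  | empty =>
    obtain ⟨X, Y, hXY⟩ := hxy
    exact ⟨X, Y, jac x y X Y, hXY, by simp, by simp⟩
  | insert j J hj ih =>
    obtain ⟨e₁, e₂, c, hc, hjac, htan⟩ := ih (h.mono (Finset.subset_insert _ _))
    have hjm := Finset.mem_insert_self j J
    have hz := h.zero j hjm
    -- Elementary modification: if `e₂ (f j) = a e₁ (f j)` on the new curve, then `f j • e₁` and `e₂
    -- - a • e₁` are tangent to it, and the determinant gains exactly the factor `f j`.
    have main : ∀ (e₁ e₂ : VField (Smooth S)) (c : Smooth S), c p ≠ 0 →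
        (∀ᶠ q in 𝓝 p, jac x y e₁ e₂ q = c q * ∏ j ∈ J, f j q) →
        (∀ j ∈ J, ∀ᶠ q in 𝓝 p, f j q = 0 → e₁ (f j) q = 0 ∧ e₂ (f j) q = 0) →
        (∃ a : Smooth S, ∀ᶠ q in 𝓝 p, f j q = 0 → e₂ (f j) q = a q * e₁ (f j) q) →
        ∃ (e₁ e₂ : VField (Smooth S)) (c : Smooth S), c p ≠ 0 ∧
          (∀ᶠ q in 𝓝 p, jac x y e₁ e₂ q = c q * ∏ i ∈ insert j J, f i q) ∧
          ∀ i ∈ insert j J, ∀ᶠ q in 𝓝 p, f i q = 0 → e₁ (f i) q = 0 ∧ e₂ (f i) q = 0 := by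
      rintro e₁ e₂ c hc hjac htan ⟨a, ha⟩
      have v₁ (g : Smooth S) (q : S) : (f j • e₁) g q = f j q * e₁ g q := rfl
      have v₂ (g : Smooth S) (q : S) : (e₂ - a • e₁) g q = e₂ g q - a q * e₁ g q := rfl
      refine ⟨f j • e₁, e₂ - a • e₁, c, hc, ?_, ?_⟩
      · filter_upwards [hjac] with q hq
        rw [jac_apply] at hq
        rw [jac_apply, v₁, v₁, v₂, v₂, Finset.prod_insert hj]
        linear_combination f j q * hq
      · intro i hi
        rcases Finset.mem_insert.1 hi with rfl | hi
        · filter_upwards [ha] with q h1 h2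
          rw [v₁, v₂, h2, h1 h2, zero_mul, sub_self]
          exact ⟨rfl, rfl⟩
        · filter_upwards [htan i hi] with q h1 h2
          rw [v₁, v₂, (h1 h2).1, (h1 h2).2]
          simp
    obtain ⟨t, w, ht, hw, hcoord, hjac'⟩ := hxy.exists_coord (h.ne_zero j hjm)
    obtain ⟨u, hu, hu0, hprod⟩ := hcoord.exists_restrict_prod hz ht J fun i hi =>
      ⟨h.zero i (Finset.mem_insert_of_mem hi), h.coord j hjm i (Finset.mem_insert_of_mem hi)
        (by rintro rfl; exact hj hi)⟩
    obtain ⟨φ₁, hφ₁, r₁⟩ := hcoord.exists_restrict (e₁ (f j))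
    obtain ⟨φ₂, hφ₂, r₂⟩ := hcoord.exists_restrict (e₂ (f j))
    obtain ⟨A, hA, rA⟩ := hcoord.exists_restrict (e₂ t)
    obtain ⟨B, hB, rB⟩ := hcoord.exists_restrict (e₁ t)
    obtain ⟨κ, hκ, rκ⟩ := hcoord.exists_restrict (w * c)
    have hκ0 : κ 0 ≠ 0 := by
      have h0 : w p * c p = κ (t p) := rκ.self_of_nhds hz
      rw [ht] at h0
      rw [← h0]
      exact mul_ne_zero hw hc
    -- This is the determinant of `e₁`, `e₂` in the coordinates `f j`, `t`, restricted to the curve.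
    -- It is a power of `t` times a unit, so one of `e₁ (f j)`, `e₂ (f j)` divides the other there.
    have key : ∀ᶠ s in 𝓝 (0 : ℝ), φ₁ s * A s - φ₂ s * B s = s ^ J.card * (u s * κ s) := by
      rw [← hcoord.eventually_curve_iff hz ht]
      filter_upwards [hprod, r₁, r₂, rA, rB, rκ, hjac' e₁ e₂, hjac]
        with q h1 h2 h3 h4 h5 h6 h7 h8 hq
      rw [jac_apply, h8, h1 hq, h2 hq, h3 hq, h4 hq, h5 hq] at h7
      have h6' : w q * c q = κ (t q) := h6 hq
      linear_combination h7 + t q ^ J.card * u (t q) * h6'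
    have smooth {a : ℝ → ℝ} (ha : ContDiff ℝ ∞ a) : ∃ b : Smooth S, ∀ q, b q = a (t q) :=
      ⟨⟨fun q => a (t q), ha.contMDiff.comp t.contMDiff⟩, fun _ => rfl⟩
    rcases germ_dvd_or_dvd J.card hφ₁ hφ₂ hA.continuous hB.continuous
      (hu.mul hκ).continuous (mul_ne_zero hu0 hκ0) key with ⟨a, ha, hdvd⟩ | ⟨a, ha, hdvd⟩
    · obtain ⟨b, hb⟩ := smooth ha
      refine main e₁ e₂ c hc hjac htan ⟨b, ?_⟩
      rw [← hcoord.eventually_curve_iff hz ht] at hdvd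
      filter_upwards [hdvd, r₁, r₂] with q h1 h2 h3 hq
      rw [h2 hq, h3 hq, h1 hq, hb]
    · obtain ⟨b, hb⟩ := smooth ha
      -- Exchanging the two fields changes the sign of the determinant.
      refine main e₂ e₁ (-c) (neg_ne_zero.2 hc) ?_ (fun i hi => ?_) ⟨b, ?_⟩
      · filter_upwards [hjac] with q hq
        change _ = -c q * _
        rw [jac_apply] at hq ⊢
        linear_combination -hq
      · filter_upwards [htan i hi] with q h1 h2
        exact (h1 h2).symm
      · rw [← hcoord.eventually_curve_iff hz ht] at hdvd
        filter_upwards [hdvd, r₁, r₂] with q h1 h2 h3 hq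
        rw [h2 hq, h3 hq, h1 hq, hb]

end Curves

/-! ### Gluing across the divisor, its local equations, and local frames of `b`-fields. -/

section Divisor

variable {S : Type*} [TopologicalSpace S] [ChartedSpace (EuclideanSpace ℝ (Fin 2)) S]

section Gluing

variable {V : Set S}

/-- A function that extends smoothly across the complement of a dense set near every point extends
smoothly. -/
theorem exists_smooth_of_local (hV : Dense V) (φ : S → ℝ)
    (h : ∀ p, ∃ f : Smooth S, ∀ᶠ q in 𝓝 p, q ∈ V → φ q = f q) :
    ∃ f : Smooth S, ∀ q ∈ V, f q = φ q := by
  choose f hf using h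
  have hloc (p : S) : ∀ᶠ q in 𝓝 p, f q q = f p q := by
    refine (hf p).eventually_nhds.mono fun q hq => ?_
    refine (eventuallyEq_of_dense hV (smooth_continuous _) (smooth_continuous _) ?_).self_of_nhds
    filter_upwards [hq, hf q] with r h1 h2 h3
    rw [← h1 h3, h2 h3]
  refine ⟨⟨fun q => f q q, fun p => ?_⟩, fun q hq => ((hf q).self_of_nhds hq).symm⟩
  exact (f p).contMDiff.contMDiffAt.congr_of_eventuallyEq (hloc p)

/-- Meant for functionals given by a quotient, where `φ` is meaningful only off the divisor;
linearity passes to the extension by density. -/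
theorem exists_linearMap_of_local (hV : Dense V) {M : Type*} [AddCommGroup M]
    [Module (Smooth S) M] (φ : M → S → ℝ) (hadd : ∀ m m' q, q ∈ V → φ (m + m') q = φ m q + φ m' q)
    (hsmul : ∀ (f : Smooth S) m q, q ∈ V → φ (f • m) q = f q * φ m q)
    (h : ∀ m p, ∃ f : Smooth S, ∀ᶠ q in 𝓝 p, q ∈ V → φ m q = f q) :
    ∃ l : M →ₗ[Smooth S] Smooth S, ∀ m, ∀ q ∈ V, l m q = φ m q := by
  choose l hl using fun m => exists_smooth_of_local hV (φ m) (h m)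
  have ext {f g : Smooth S} (hfg : ∀ q ∈ V, f q = g q) : f = g := by
    ext q
    exact congrFun (Continuous.ext_on hV (smooth_continuous f) (smooth_continuous g) hfg) q
  refine ⟨{
    toFun := l
    map_add' := fun m m' => ext fun q hq => ?_
    map_smul' := fun f m => ext fun q hq => ?_ }, hl⟩
  · change l (m + m') q = l m q + l m' q
    rw [hl _ q hq, hl _ q hq, hl _ q hq, hadd _ _ q hq]
  · change l (f • m) q = f q * l m q
    rw [hl _ q hq, hl _ q hq, hsmul _ _ q hq]

end Gluing

variable {n : ℕ} (D : Fin n → Set S)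

/-- The complement of the divisor. -/
def compl : Set S := {q | ∀ i, q ∉ D i}

/-- `F` is an equation of the divisor near `q`: it does not vanish off the divisor, and the smooth
functions that vanish on the divisor are its multiples. -/
def IsEquationAt (F : Smooth S) (q : S) : Prop :=
  (∀ᶠ r in 𝓝 q, r ∈ compl D → F r ≠ 0) ∧
    ∀ d : Smooth S, (∀ i, ∀ r ∈ D i, d r = 0) → ∃ d' : Smooth S, ∀ᶠ r in 𝓝 q, d r = F r * d' r

/-- A frame of the `b`-tangent bundle near `p`, together with coordinates and an equation of the
divisor. -/
structure LocalFrame (p : S) where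
  x : Smooth S
  y : Smooth S
  F : Smooth S
  c : Smooth S
  e₁ : bFields D
  e₂ : bFields D
  coord : IsCoord x y p
  c_ne : c p ≠ 0
  jac_eq : ∀ᶠ q in 𝓝 p, jac x y e₁ e₂ q = c q * F q
  F_eq : ∀ i, p ∈ D i → F p = 0
  eqn : IsEquationAt D F p
  -- This makes `det(e₁, v) / F` extend smoothly on all of `S` for each `b`-field `v`: where `F`
  -- ceases to be an equation, `e₁` is identically zero.
  eqn_or : ∀ q, IsEquationAt D F q ∨
    ∀ᶠ r in 𝓝 q, ∀ g : Smooth S, (e₁ : VField (Smooth S)) g r = 0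

theorem IsStarDivisor.isOpen_compl {D : Fin n → Set S} (hD : IsStarDivisor D) :
    IsOpen (compl D) := by
  have : compl D = ⋂ i, (D i)ᶜ := by
    ext q
    simp [compl]
  rw [this]
  exact isOpen_iInter_of_finite fun i => (hD.curve i).1.isOpen_compl

variable [T2Space S] [IsManifold (𝓡 2) ∞ S]

/-- Near `q` such a `g` is a multiple of `f`, so by Leibniz tangency to `Z` can be tested on `f`
alone. -/
theorem IsDefining.apply_eq_zero {Z : Set S} {f : Smooth S} {q : S} (h : IsDefining Z f q)
    (hq : q ∈ Z) {X : VField (Smooth S)} (hX : X f q = 0) {g : Smooth S}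
    (hg : ∀ r ∈ Z, g r = 0) : X g q = 0 := by
  obtain ⟨t, -, hc⟩ := exists_coord h.ne_zero
  obtain ⟨g', hg'⟩ := hc.exists_eq_mul (h.vanish q hq) (f := g)
    (h.mem.mono fun r hr hfr => hg r (hr hfr))
  rw [(vField_congr X (h := f * g') hg').self_of_nhds, Derivation.leibniz]
  change f q * X g' q + g' q * X f q = 0
  rw [hX, h.vanish q hq, zero_mul, mul_zero, add_zero]

variable {D}

/-- A curve has no interior, as its defining function would vanish near an interior point and have
zero differential there; a finite intersection of dense open sets is dense. -/
theorem IsStarDivisor.dense_compl (hD : IsStarDivisor D) : Dense (compl D) := by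
  classical
  have h1 (i : Fin n) : Dense (D i)ᶜ := by
    intro p
    by_contra hp
    have hev : ∀ᶠ q in 𝓝 p, q ∈ D i := by
      rw [mem_closure_iff_frequently, not_frequently] at hp
      exact hp.mono fun q hq => not_not.1 hq
    obtain ⟨f, hf⟩ := exists_isDefining (hD.curve i) hev.self_of_nhds
    obtain ⟨X, hX⟩ := hf.ne_zero
    apply hX
    have h0 : ∀ᶠ q in 𝓝 p, f q = (0 : Smooth S) q := hev.mono fun q hq => hf.vanish q hq
    rw [(vField_congr X h0).self_of_nhds, map_zero]
    rfl
  have h2 (J : Finset (Fin n)) : Dense {q | ∀ i ∈ J, q ∉ D i} := by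
    induction J using Finset.induction_on with
    | empty => simp
    | insert i J _ ih =>
      have : {q | ∀ j ∈ insert i J, q ∉ D j} = (D i)ᶜ ∩ {q | ∀ j ∈ J, q ∉ D j} := by
        ext q
        simp
      rw [this]
      exact (h1 i).inter_of_isOpen_left ih (hD.curve i).1.isOpen_compl
  simpa [compl] using h2 Finset.univ

/-- Smooth functions that agree off the divisor near `p` agree near `p`. -/
theorem IsStarDivisor.eventually_eq (hD : IsStarDivisor D) {f g : S → ℝ}
    (hf : Continuous f) (hg : Continuous g) {p : S}
    (h : ∀ᶠ q in 𝓝 p, q ∈ compl D → f q = g q) : ∀ᶠ q in 𝓝 p, f q = g q :=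
  eventuallyEq_of_dense hD.dense_compl hf hg h

theorem IsStarDivisor.isTransverseFamily (hD : IsStarDivisor D)
    {f : Fin n → Smooth S} {J : Finset (Fin n)} {p : S}
    (hf : ∀ j ∈ J, p ∈ D j ∧ IsDefining (D j) (f j) p) : IsTransverseFamily f J p where
  zero j hj := (hf j hj).2.vanish p (hf j hj).1
  ne_zero j hj := (hf j hj).2.ne_zero
  coord i hi j hj hij := isCoord_of_transverse (hf i hi).2 (hf j hj).2
    (hD.transverse i j hij p ⟨(hf i hi).1, (hf j hj).1⟩)

theorem IsStarDivisor.isEquationAt_prod (hD : IsStarDivisor D)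
    {f : Fin n → Smooth S} {J : Finset (Fin n)} {p : S}
    (hf : ∀ j ∈ J, IsDefining (D j) (f j) p) : IsEquationAt D (∏ j ∈ J, f j) p := by
  classical
  have hcoe (K : Finset (Fin n)) (q : S) : (∏ j ∈ K, f j) q = ∏ j ∈ K, f j q :=
    map_prod (ContMDiffMap.evalRingHom (I := 𝓡 2) (n := ∞) q) f K
  refine ⟨?_, fun d hd => ?_⟩
  · filter_upwards [(eventually_all_finset J).2 fun j hj => (hf j hj).mem] with q hq hqc
    rw [hcoe, Finset.prod_ne_zero_iff]
    exact fun j hj h0 => hqc j (hq j hj h0)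
  -- Only the factors vanishing at `p` form a transverse family; the product of the others is a unit
  -- and is inverted.
  set K := J.filter fun j => f j p = 0 with hK
  have hmem : ∀ j ∈ K, p ∈ D j ∧ IsDefining (D j) (f j) p := fun j hj => by
    obtain ⟨h1, h2⟩ := Finset.mem_filter.1 hj
    exact ⟨(hf j h1).mem.self_of_nhds h2, hf j h1⟩
  obtain ⟨d', hd'⟩ := (hD.isTransverseFamily hmem).exists_eq_prod_mul (d := d) fun j hj =>
    (hmem j hj).2.mem.mono fun q hq h0 => hd j q (hq h0)
  have hne : (∏ j ∈ J \ K, f j) p ≠ 0 := by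
    rw [hcoe, Finset.prod_ne_zero_iff]
    intro j hj
    obtain ⟨h1, h2⟩ := Finset.mem_sdiff.1 hj
    exact fun h0 => h2 (Finset.mem_filter.2 ⟨h1, h0⟩)
  obtain ⟨g, hg⟩ := exists_smooth_inv hne
  refine ⟨g * d', ?_⟩
  filter_upwards [hd', hg] with q h1 h2
  rw [← Finset.prod_sdiff (Finset.filter_subset (fun j => f j p = 0) J), ← hK]
  change d q = (∏ j ∈ J \ K, f j) q * (∏ j ∈ K, f j) q * (g q * d' q)
  rw [h1, hcoe K]
  linear_combination -(∏ j ∈ K, f j q) * d' q * h2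

/-- The `b`-tangent bundle is locally free. -/
theorem IsStarDivisor.nonempty_localFrame (hD : IsStarDivisor D) (p : S) :
    Nonempty (LocalFrame D p) := by
  classical
  have hex (i : Fin n) : ∃ f : Smooth S, p ∈ D i → IsDefining (D i) f p := by
    by_cases hp : p ∈ D i
    · obtain ⟨f, hf⟩ := exists_isDefining (hD.curve i) hp
      exact ⟨f, fun _ => hf⟩
    · exact ⟨0, fun h => absurd h hp⟩
  choose f hf using hex
  set J : Finset (Fin n) := Finset.univ.filter fun i => p ∈ D i with hJ
  have hmJ (i : Fin n) : i ∈ J ↔ p ∈ D i := by simp [hJ]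
  have hdef : ∀ j ∈ J, p ∈ D j ∧ IsDefining (D j) (f j) p := fun j hj =>
    ⟨(hmJ j).1 hj, hf j ((hmJ j).1 hj)⟩
  obtain ⟨x, y, hxy, -⟩ := exists_chart_coord p
  obtain ⟨e₁, e₂, c, hc, hjac, htan⟩ := (hD.isTransverseFamily hdef).exists_frame hxy
  have hcoe (q : S) : (∏ j ∈ J, f j) q = ∏ j ∈ J, f j q :=
    map_prod (ContMDiffMap.evalRingHom (I := 𝓡 2) (n := ∞) q) f J
  -- On this neighbourhood the frame is tangent to all curves present; multiplying by a bump
  -- supported in it turns the frame into global `b`-fields.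
  have hW : ∀ᶠ q in 𝓝 p, (∀ j ∈ J, IsDefining (D j) (f j) q) ∧
      (∀ j ∈ J, f j q = 0 → e₁ (f j) q = 0 ∧ e₂ (f j) q = 0) ∧ ∀ j, j ∉ J → q ∉ D j := by
    refine ((eventually_all_finset J).2 fun j hj => (hdef j hj).2.eventually).and
      (((eventually_all_finset J).2 htan).and (eventually_all.2 fun j => ?_))
    by_cases hj : j ∈ J
    · exact Eventually.of_forall fun q h => absurd hj h
    · filter_upwards [(hD.curve j).1.isOpen_compl.mem_nhds fun h => hj ((hmJ j).2 h)]
        with q hq _ using hq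
  obtain ⟨g, hg1, hg0⟩ := exists_bump hW
  have hb (e : VField (Smooth S)) (he : ∀ q, ((∀ j ∈ J, IsDefining (D j) (f j) q) ∧
      (∀ j ∈ J, f j q = 0 → e₁ (f j) q = 0 ∧ e₂ (f j) q = 0) ∧ ∀ j, j ∉ J → q ∉ D j) →
      ∀ j ∈ J, f j q = 0 → e (f j) q = 0) : g • e ∈ bFields D := by
    intro i h hh q hq
    change g q * e h q = 0
    by_cases hqW : (∀ j ∈ J, IsDefining (D j) (f j) q) ∧
      (∀ j ∈ J, f j q = 0 → e₁ (f j) q = 0 ∧ e₂ (f j) q = 0) ∧ ∀ j, j ∉ J → q ∉ D j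
    · have hi : i ∈ J := by
        by_contra hi
        exact hqW.2.2 i hi hq
      have hdi := hqW.1 i hi
      rw [hdi.apply_eq_zero hq (he q hqW i hi (hdi.vanish q hq)) hh, mul_zero]
    · rw [(hg0 q hqW).self_of_nhds, zero_mul]
  refine ⟨{
    x := x, y := y, F := ∏ j ∈ J, f j, c := c
    e₁ := ⟨g • e₁, hb e₁ fun q hq j hj h0 => (hq.2.1 j hj h0).1⟩
    e₂ := ⟨g • e₂, hb e₂ fun q hq j hj h0 => (hq.2.1 j hj h0).2⟩
    coord := hxy, c_ne := hc, jac_eq := ?_, F_eq := ?_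
    eqn := hD.isEquationAt_prod fun j hj => (hdef j hj).2
    eqn_or := fun q => ?_ }⟩
  · filter_upwards [hjac, hg1] with q h1 h2
    rw [hcoe, ← h1]
    change (g q * e₁ x q) * (g q * e₂ y q) - (g q * e₁ y q) * (g q * e₂ x q) = _
    rw [h2, jac_apply]
    ring
  · intro i hi
    rw [hcoe, Finset.prod_eq_zero ((hmJ i).2 hi) ((hf i hi).vanish p hi)]
  · by_cases hqW : (∀ j ∈ J, IsDefining (D j) (f j) q) ∧
      (∀ j ∈ J, f j q = 0 → e₁ (f j) q = 0 ∧ e₂ (f j) q = 0) ∧ ∀ j, j ∉ J → q ∉ D j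
    · exact Or.inl (hD.isEquationAt_prod hqW.1)
    · refine Or.inr ((hg0 q hqW).mono fun r hr h => ?_)
      change g r * e₁ h r = 0
      rw [hr, zero_mul]

end Divisor

/-! ### The symplectic form in a local frame; rigged fields are the fields vanishing on the divisor.
-/

section Rigged

variable {S : Type*} [TopologicalSpace S] [ChartedSpace (EuclideanSpace ℝ (Fin 2)) S]
  {n : ℕ} {D : Fin n → Set S}

theorem bTwoForm_swap (Ω : BTwoForm D) (u v : bFields D) : Ω ![v, u] = -Ω ![u, v] := by
  have h := Ω.map_swap ![u, v] (i := 0) (j := 1) (by simp)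
  have hs : ![u, v] ∘ Equiv.swap (0 : Fin 2) 1 = ![v, u] := by
    ext i : 1
    fin_cases i <;> simp
  rw [hs] at h
  exact h

theorem bTwoForm_self (Ω : BTwoForm D) (u : bFields D) : Ω ![u, u] = 0 :=
  Ω.map_eq_zero_of_eq ![u, u] (i := 0) (j := 1) rfl (by simp)

theorem zeroFields_le_bFields : zeroFields D ≤ bFields D :=
  fun _ hX i f _ q hq => hX i q hq f

/-- A vector field multiplied by a function that vanishes on the divisor. -/
noncomputable def mulField (ρ : Smooth S) (hρ : ∀ i, ∀ q ∈ D i, ρ q = 0) (X : VField (Smooth S)) :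
    bFields D :=
  ⟨ρ • X, fun i f _ q hq => by
    change ρ q * X f q = 0
    rw [hρ i q hq, zero_mul]⟩

theorem bTwoForm_mulField (Ω : BTwoForm D) (u v : bFields D) (ρ : Smooth S)
    (hρ : ∀ i, ∀ q ∈ D i, ρ q = 0) : Ω ![u, mulField ρ hρ v] = ρ * Ω ![u, v] := by
  have h : mulField ρ hρ v = ρ • v := rfl
  rw [bTwoForm_swap, h, bTwoForm_smul_left, bTwoForm_swap Ω u v]
  ring

variable [T2Space S] [IsManifold (𝓡 2) ∞ S]

/-- Multiplication by `ρ` turns every vector field into a `b`-field, so `Ω` can be evaluated on it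
and `ρ` divided out off the divisor. -/
theorem exists_smooth_compl [SecondCountableTopology S] (hD : IsStarDivisor D) :
    ∃ ρ : Smooth S, ∀ q, ρ q ≠ 0 ↔ q ∈ compl D := by
  have := ChartedSpace.locallyCompactSpace (EuclideanSpace ℝ (Fin 2)) S
  obtain ⟨f, hf, hs, -⟩ := hD.isOpen_compl.exists_contMDiff_support_eq (n := ⊤) (𝓡 2)
  refine ⟨⟨f, hs⟩, fun q => ?_⟩
  rw [← hf]
  rfl

/-- Two vector fields tangent to a curve are dependent along it. -/
theorem jac_eq_zero (hD : IsStarDivisor D) (x y : Smooth S) (u v : bFields D) (i : Fin n) (q : S)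
    (hq : q ∈ D i) : jac x y u v q = 0 := by
  obtain ⟨f, hf⟩ := exists_isDefining (hD.curve i) hq
  obtain ⟨t, -, hc⟩ := exists_coord hf.ne_zero
  obtain ⟨x₁, x₂, hx⟩ := hc.exists_partial x
  obtain ⟨y₁, y₂, hy⟩ := hc.exists_partial y
  have hu := u.2 i f hf.vanish q hq
  have hv := v.2 i f hf.vanish q hq
  rw [jac_apply, (hx u).self_of_nhds, (hx v).self_of_nhds, (hy u).self_of_nhds,
    (hy v).self_of_nhds, hu, hv]
  ring

theorem bTwoForm_cramer (Ω : BTwoForm D) {x y : Smooth S} {p : S} (hxy : IsCoord x y p)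
    (e₁ e₂ u v : bFields D) : ∀ᶠ q in 𝓝 p, jac x y e₁ e₂ q * Ω ![u, v] q =
      jac x y u e₂ q * Ω ![e₁, v] q + jac x y e₁ u q * Ω ![e₂, v] q := by
  obtain ⟨g, hg1, hg⟩ := hxy.exists_cramer
  have hrel : (g * jac x y e₁ e₂) • u = (g * jac x y u e₂) • e₁ + (g * jac x y e₁ u) • e₂ :=
    Subtype.ext (hg e₁ e₂ u)
  have h := congrArg (fun w => Ω ![w, v]) hrel
  simp only [bTwoForm_add_left, bTwoForm_smul_left] at h
  filter_upwards [hg1] with q hq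
  have h' : g q * jac x y e₁ e₂ q * Ω ![u, v] q = g q * jac x y u e₂ q * Ω ![e₁, v] q
    + g q * jac x y e₁ u q * Ω ![e₂, v] q := congrArg (fun k : Smooth S => k q) h
  rw [hq] at h'
  linear_combination h'

namespace LocalFrame

variable {p : S} (L : LocalFrame D p)

/-- In a local frame, a `b`-two-form is a multiple of the determinant divided by the equation of the
divisor. -/
theorem bTwoForm_eq (hD : IsStarDivisor D) (Ω : BTwoForm D) (u v : bFields D) :
    ∀ᶠ q in 𝓝 p, Ω ![u, v] q * (L.c q * L.F q) = Ω ![L.e₁, L.e₂] q * jac L.x L.y u v q := by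
  refine hD.eventually_eq
    ((smooth_continuous _).mul ((smooth_continuous _).mul (smooth_continuous _)))
    ((smooth_continuous _).mul (smooth_continuous _)) ?_
  filter_upwards [bTwoForm_cramer Ω L.coord L.e₁ L.e₂ u v, L.jac_eq, L.eqn.1,
    bTwoForm_cramer Ω L.coord L.e₁ L.e₂ v L.e₁, bTwoForm_cramer Ω L.coord L.e₁ L.e₂ v L.e₂,
    (smooth_continuous L.c).continuousAt.eventually_ne L.c_ne] with q h1 h2 h3 h4 h5 h6 hq
  simp only [Pi.mul_apply]
  have ev {k l : Smooth S} (h : k = l) : k q = l q := by rw [h]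
  have s₁ : Ω ![L.e₁, v] q = -Ω ![v, L.e₁] q := ev (bTwoForm_swap Ω v L.e₁)
  have s₂ : Ω ![L.e₂, v] q = -Ω ![v, L.e₂] q := ev (bTwoForm_swap Ω v L.e₂)
  have s₃ : Ω ![L.e₂, L.e₁] q = -Ω ![L.e₁, L.e₂] q := ev (bTwoForm_swap Ω L.e₁ L.e₂)
  have z₁ : Ω ![L.e₁, L.e₁] q = 0 := ev (bTwoForm_self Ω L.e₁)
  have z₂ : Ω ![L.e₂, L.e₂] q = 0 := ev (bTwoForm_self Ω L.e₂)
  have hne : jac L.x L.y L.e₁ L.e₂ q ≠ 0 := by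
    rw [h2]
    exact mul_ne_zero h6 (h3 hq)
  rw [← h2]
  refine mul_left_cancel₀ hne ?_
  -- The Plücker relation for four vectors in the plane; Cramer's rule in each argument of `Ω`
  -- produces its left-hand side.
  have pl : jac L.x L.y L.e₁ u q * jac L.x L.y v L.e₂ q
      - jac L.x L.y u L.e₂ q * jac L.x L.y L.e₁ v q
      = -(jac L.x L.y L.e₁ L.e₂ q * jac L.x L.y u v q) := by
    simp only [jac_apply]
    ring
  linear_combination
    jac L.x L.y L.e₁ L.e₂ q * h1
    + jac L.x L.y u L.e₂ q * (jac L.x L.y L.e₁ L.e₂ q * s₁ - h4 - jac L.x L.y v L.e₂ q * z₁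
      - jac L.x L.y L.e₁ v q * s₃)
    + jac L.x L.y L.e₁ u q * (jac L.x L.y L.e₁ L.e₂ q * s₂ - h5 - jac L.x L.y L.e₁ v q * z₂)
    - Ω ![L.e₁, L.e₂] q * pl

/-- The coefficient of a star log symplectic form in a local frame does not vanish. -/
theorem bTwoForm_frame_ne_zero (hD : IsStarDivisor D) {Ω : BTwoForm D}
    (hΩ : IsStarLogSymplectic D Ω) : Ω ![L.e₁, L.e₂] p ≠ 0 := by
  -- The functional `v ↦ det(e₁, v) / F` takes the value `c` at `e₂`. If `Ω(u, ·)` represents it and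
  -- `det(u, e₂) = F d`, the frame formula at `(u, e₂)` gives `c² = Ω(e₁, e₂) d`, so `Ω(e₁, e₂)` is
  -- a unit at `p`.
  obtain ⟨l, hl⟩ := exists_linearMap_of_local hD.dense_compl (M := bFields D)
    (fun v q => jac L.x L.y L.e₁ v q / L.F q)
    (fun v w q _ => by
      rw [Submodule.coe_add, jac_add]
      exact add_div _ _ _)
    (fun f v q _ => by
      rw [Submodule.coe_smul, jac_smul]
      exact mul_div_assoc _ _ _)
    (fun v q => by
      rcases L.eqn_or q with ⟨hne, hdiv⟩ | h0
      · obtain ⟨d, hd⟩ := hdiv _ (jac_eq_zero hD L.x L.y L.e₁ v)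
        refine ⟨d, ?_⟩
        filter_upwards [hne, hd] with r h1 h2 hr
        rw [h2, mul_div_cancel_left₀ _ (h1 hr)]
      · refine ⟨0, h0.mono fun r hr _ => ?_⟩
        rw [jac_apply, hr, hr]
        simp)
  obtain ⟨u, hu, -⟩ := hΩ.nondegenerate l
  obtain ⟨d, hd⟩ := L.eqn.2 _ (jac_eq_zero hD L.x L.y u L.e₂)
  have key : ∀ᶠ q in 𝓝 p, L.c q * L.c q = Ω ![L.e₁, L.e₂] q * d q := by
    refine hD.eventually_eq ((smooth_continuous _).mul (smooth_continuous _))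
      ((smooth_continuous _).mul (smooth_continuous _)) ?_
    filter_upwards [L.bTwoForm_eq hD Ω u L.e₂, hd, L.eqn.1, L.jac_eq] with q h1 h2 h3 h4 hq
    rw [hu, hl _ q hq, h2, h4, mul_div_cancel_right₀ _ (h3 hq)] at h1
    simp only [Pi.mul_apply]
    refine mul_right_cancel₀ (h3 hq) ?_
    linear_combination h1
  intro h0
  have h1 := key.self_of_nhds
  rw [h0, zero_mul] at h1
  exact L.c_ne (mul_self_eq_zero.1 h1)

end LocalFrame

theorem smooth_ext (hD : IsStarDivisor D) {f g : Smooth S} (h : ∀ q ∈ compl D, f q = g q) :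
    f = g := by
  ext q
  exact congrFun (Continuous.ext_on hD.dense_compl (smooth_continuous f) (smooth_continuous g) h) q

theorem rigged_le_zeroFields [SecondCountableTopology S] (hD : IsStarDivisor D) {Ω : BTwoForm D}
    (hΩ : IsStarLogSymplectic D Ω) : rigged Ω ≤ zeroFields D := by
  rintro _ ⟨u, rfl, α, hα⟩ i p hp f
  obtain ⟨ρ, hρ⟩ := exists_smooth_compl hD
  have hρ0 : ∀ i, ∀ q ∈ D i, ρ q = 0 := fun i q hq => by
    by_contra h
    exact (hρ q).1 h i hq
  obtain ⟨L⟩ := hD.nonempty_localFrame p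
  -- The frame formula, applied to `ρ X` and divided by `ρ`, holds for every `X` with `α X` in place
  -- of `Ω(u, X)`. At `p` the factor `F` vanishes and `Ω(e₁, e₂)` does not.
  have hjac (X : VField (Smooth S)) : jac L.x L.y u X p = 0 := by
    have key : ∀ᶠ q in 𝓝 p, α X q * (L.c q * L.F q)
        = Ω ![L.e₁, L.e₂] q * jac L.x L.y u X q := by
      refine hD.eventually_eq
        ((smooth_continuous _).mul ((smooth_continuous _).mul (smooth_continuous _)))
        ((smooth_continuous _).mul (smooth_continuous _)) ?_
      filter_upwards [L.bTwoForm_eq hD Ω u (mulField ρ hρ0 X)] with q h1 hq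
      simp only [Pi.mul_apply]
      refine mul_left_cancel₀ ((hρ q).2 hq) ?_
      have h2 : Ω ![u, mulField ρ hρ0 X] = ρ * α X := (hα _).trans (α.map_smul ρ X)
      rw [h2] at h1
      change ρ q * α X q * _ = _ * (_ * (ρ q * _) - _ * (ρ q * _)) at h1
      rw [jac_apply]
      linear_combination h1
    have h1 := key.self_of_nhds
    rw [L.F_eq i hp, mul_zero, mul_zero] at h1
    exact (mul_eq_zero.1 h1.symm).resolve_left (L.bTwoForm_frame_ne_zero hD hΩ)
  obtain ⟨X, Y, hXY⟩ := L.coord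
  have hX := hjac X
  have hY := hjac Y
  rw [jac_apply] at hX hY hXY
  refine L.coord.vField_apply_eq_zero ?_ ?_ f
  · refine (mul_eq_zero.1 ?_).resolve_left hXY
    linear_combination -Y L.x p * hX + X L.x p * hY
  · refine (mul_eq_zero.1 ?_).resolve_left hXY
    linear_combination -Y L.y p * hX + X L.y p * hY

theorem zeroFields_le_rigged [SecondCountableTopology S] (hD : IsStarDivisor D) (Ω : BTwoForm D) :
    zeroFields D ≤ rigged Ω := by
  intro U hU
  obtain ⟨ρ, hρ⟩ := exists_smooth_compl hD
  have hρ0 : ∀ i, ∀ q ∈ D i, ρ q = 0 := fun i q hq => by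
    by_contra h
    exact (hρ q).1 h i hq
  let u : bFields D := ⟨U, zeroFields_le_bFields hU⟩
  have hadd (X Y : VField (Smooth S)) : Ω ![u, mulField ρ hρ0 (X + Y)]
      = Ω ![u, mulField ρ hρ0 X] + Ω ![u, mulField ρ hρ0 Y] := by
    have h : mulField ρ hρ0 (X + Y) = mulField ρ hρ0 X + mulField ρ hρ0 Y :=
      Subtype.ext (smul_add ρ X Y)
    rw [bTwoForm_swap, h, bTwoForm_add_left, bTwoForm_swap Ω u (mulField ρ hρ0 X),
      bTwoForm_swap Ω u (mulField ρ hρ0 Y)]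
    ring
  have hsmul (f : Smooth S) (X : VField (Smooth S)) : Ω ![u, mulField ρ hρ0 (f • X)]
      = f * Ω ![u, mulField ρ hρ0 X] := by
    have h : mulField ρ hρ0 (f • X) = f • mulField ρ hρ0 X := Subtype.ext (smul_comm ρ f X)
    rw [bTwoForm_swap, h, bTwoForm_smul_left, bTwoForm_swap Ω u (mulField ρ hρ0 X)]
    ring
  -- The one-form is `X ↦ Ω(u, ρ X) / ρ`. It extends across the divisor because the components of
  -- `U` are divisible by `F`, which cancels the pole of `Ω`.
  obtain ⟨α, hα⟩ := exists_linearMap_of_local hD.dense_compl (M := VField (Smooth S))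
    (fun X q => Ω ![u, mulField ρ hρ0 X] q / ρ q)
    (fun X Y q _ => by
      rw [hadd]
      exact add_div _ _ _)
    (fun f X q _ => by
      rw [hsmul]
      exact mul_div_assoc _ _ _)
    (fun X p => by
      obtain ⟨L⟩ := hD.nonempty_localFrame p
      obtain ⟨a, ha⟩ := L.eqn.2 (U L.x) fun i q hq => hU i q hq _
      obtain ⟨b, hb⟩ := L.eqn.2 (U L.y) fun i q hq => hU i q hq _
      obtain ⟨c', hc'⟩ := exists_smooth_inv L.c_ne
      refine ⟨Ω ![L.e₁, L.e₂] * c' * (a * X L.y - b * X L.x), ?_⟩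
      filter_upwards [ha, hb, hc', L.eqn.1, L.bTwoForm_eq hD Ω u (mulField ρ hρ0 X)]
        with q h1 h2 h3 h4 h5 hq
      change _ = Ω ![L.e₁, L.e₂] q * c' q * (a q * X L.y q - b q * X L.x q)
      change _ = _ * (U L.x q * (ρ q * X L.y q) - U L.y q * (ρ q * X L.x q)) at h5
      rw [h1, h2] at h5
      rw [div_eq_iff ((hρ q).2 hq)]
      refine mul_left_cancel₀ (h4 hq) ?_
      linear_combination c' q * h5 - Ω ![u, mulField ρ hρ0 X] q * L.F q * h3)
  refine ⟨u, rfl, α, fun v => smooth_ext hD fun q hq => ?_⟩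
  rw [hα _ q hq, bTwoForm_mulField]
  exact (mul_div_cancel_left₀ _ ((hρ q).2 hq)).symm

theorem rigged_eq_zeroFields [SecondCountableTopology S] (hD : IsStarDivisor D) {Ω : BTwoForm D}
    (hΩ : IsStarLogSymplectic D Ω) : rigged Ω = zeroFields D :=
  le_antisymm (rigged_le_zeroFields hD hΩ) (zeroFields_le_rigged hD Ω)

end Rigged

/-! ### Isomorphic Lie algebroids have isomorphic cohomology -/

section Transport

variable {R : Type*} [CommRing R] [Algebra ℝ R] {A B : Type*} [AddCommGroup A] [Module R A]
  [AddCommGroup B] [Module R B]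

/-- Pullback of forms along an isomorphism of modules of sections. -/
def formEquiv (e : A ≃ₗ[R] B) (k : ℕ) : Form R B k ≃ₗ[ℝ] Form R A k where
  toFun β := AlternatingMap.compLinearMap (show B [⋀^Fin k]→ₗ[R] R from β) e.toLinearMap
  invFun β := AlternatingMap.compLinearMap (show A [⋀^Fin k]→ₗ[R] R from β) e.symm.toLinearMap
  map_add' _ _ := rfl
  map_smul' _ _ := rfl
  left_inv β := by
    refine AlternatingMap.ext (R := R) fun v => ?_
    change β (fun i => e (e.symm (v i))) = β v
    simp
  right_inv β := by
    refine AlternatingMap.ext (R := R) fun v => ?_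
    change β (fun i => e.symm (e (v i))) = β v
    simp

theorem formEquiv_apply (e : A ≃ₗ[R] B) {k : ℕ} (β : Form R B k) (v : Fin k → A) :
    formEquiv e k β v = β (fun i => e (v i)) := rfl

variable {brA : A → A → A} {ρA : A → VField R} {brB : B → B → B} {ρB : B → VField R}

theorem algebroidD_formEquiv (e : A ≃ₗ[R] B) (hρ : ∀ a, ρB (e a) = ρA a)
    (hbr : ∀ a b, e (brA a b) = brB (e a) (e b)) {k : ℕ} (β : Form R B k)
    (v : Fin (k + 1) → A) :
    algebroidD brA ρA (formEquiv e k β) v = algebroidD brB ρB β (fun i => e (v i)) := by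
  unfold algebroidD
  congr 1
  · refine Finset.sum_congr rfl fun i _ => ?_
    rw [hρ]
    rfl
  · cases k with
    | zero => rfl
    | succ m =>
      refine Finset.sum_congr rfl fun j _ => Finset.sum_congr rfl fun i _ => ?_
      congr 1
      rw [formEquiv_apply]
      congr 1
      funext l
      refine Fin.cases ?_ (fun l => ?_) l
      · simp [hbr]
      · simp

theorem nonempty_cohomology_equiv (e : A ≃ₗ[R] B) (hρ : ∀ a, ρB (e a) = ρA a)
    (hbr : ∀ a b, e (brA a b) = brB (e a) (e b)) (k : ℕ) :
    Nonempty (AlgebroidCohomology R brA ρA k ≃ₗ[ℝ] AlgebroidCohomology R brB ρB k) := by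
  have hv (k : ℕ) (w : Fin k → B) : ∃ v : Fin k → A, (fun i => e (v i)) = w :=
    ⟨fun i => e.symm (w i), by simp⟩
  have hcoc (β : Form R B k) : formEquiv e k β ∈ cocycles R brA ρA k ↔ β ∈ cocycles R brB ρB k := by
    constructor
    · intro h w
      obtain ⟨v, rfl⟩ := hv _ w
      rw [← algebroidD_formEquiv e hρ hbr]
      exact h v
    · intro h v
      exact (algebroidD_formEquiv e hρ hbr β v).trans (h _)
  have hcob (β : Form R B k) :
      formEquiv e k β ∈ coboundaries R brA ρA k ↔ β ∈ coboundaries R brB ρB k := by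
    cases k with
    | zero => exact (formEquiv e 0).map_eq_zero_iff
    | succ k =>
      constructor
      · rintro ⟨γ, hγ⟩
        obtain ⟨δ, rfl⟩ := (formEquiv e k).surjective γ
        refine ⟨δ, fun w => ?_⟩
        obtain ⟨v, rfl⟩ := hv _ w
        rw [← algebroidD_formEquiv e hρ hbr]
        exact hγ v
      · rintro ⟨δ, hδ⟩
        exact ⟨formEquiv e k δ, fun v =>
          (hδ _).trans (algebroidD_formEquiv e hρ hbr δ v).symm⟩
  let E : cocycles R brB ρB k ≃ₗ[ℝ] cocycles R brA ρA k :=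
    (formEquiv e k).ofSubmodules _ _ (by
      ext γ
      obtain ⟨β, rfl⟩ := (formEquiv e k).surjective γ
      rw [hcoc]
      refine Iff.trans (Submodule.mem_map_equiv (e := formEquiv e k) _) ?_
      rw [LinearEquiv.symm_apply_apply])
  refine ⟨(Submodule.Quotient.equiv _ _ E ?_).symm⟩
  ext γ
  obtain ⟨β, rfl⟩ := E.surjective γ
  refine Iff.trans (Submodule.mem_map_equiv (e := E) _) ?_
  rw [LinearEquiv.symm_apply_apply]
  exact (hcob β).symm

end Transport

/-! ### The Poisson structure -/

section Poisson

variable {S : Type*} [TopologicalSpace S] [ChartedSpace (EuclideanSpace ℝ (Fin 2)) S]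
  {n : ℕ} {D : Fin n → Set S} {Ω : BTwoForm D}

/-- The closedness of a `b`-two-form, written out. -/
theorem bTwoForm_closed (h : IsStarLogSymplectic D Ω) (u v w : bFields D) :
    (u : VField (Smooth S)) (Ω ![v, w]) - (v : VField (Smooth S)) (Ω ![u, w])
      + (w : VField (Smooth S)) (Ω ![u, v]) - Ω ![bBracket D u v, w] + Ω ![bBracket D u w, v]
      - Ω ![bBracket D v w, u] = 0 := by
  have : (∑ i : Fin 3, (-1 : Smooth S) ^ (i : ℕ) * (![u, v, w] i : VField (Smooth S))
        (Ω fun l => ![u, v, w] (i.succAbove l)))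
      + ∑ j : Fin 2, ∑ i ∈ Finset.Iic j, (-1 : Smooth S) ^ ((i : ℕ) + ((j : ℕ) + 1)) *
        Ω (Fin.cons (bBracket D (![u, v, w] i.castSucc) (![u, v, w] j.succ))
          fun l : Fin 1 => ![u, v, w] (j.succ.succAbove (i.succAbove l))) = 0 :=
    h.closed ![u, v, w]
  have e₀ : (fun l => ![u, v, w] (Fin.succAbove 0 l)) = ![v, w] := by
    ext i : 1
    fin_cases i <;> rfl
  have e₁ : (fun l => ![u, v, w] (Fin.succAbove 1 l)) = ![u, w] := by
    ext i : 1
    fin_cases i <;> rfl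
  have e₂ : (fun l => ![u, v, w] (Fin.succAbove 2 l)) = ![u, v] := by
    ext i : 1
    fin_cases i <;> rfl
  have ec (a : bFields D) (f : Fin 1 → bFields D) : (Fin.cons a f : Fin 2 → bFields D)
      = ![a, f 0] := by
    ext i : 1
    fin_cases i <;> rfl
  have i₀ : Finset.Iic (0 : Fin 2) = {0} := rfl
  have i₁ : Finset.Iic (1 : Fin 2) = {0, 1} := rfl
  simp only [Fin.sum_univ_three, Fin.sum_univ_two, i₀, i₁, Finset.sum_singleton,
    Finset.sum_pair (zero_ne_one (α := Fin 2)), e₀, e₁, e₂, ec] at this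
  have this' : (-1) ^ 0 * (u : VField (Smooth S)) (Ω ![v, w])
      + (-1) ^ 1 * (v : VField (Smooth S)) (Ω ![u, w])
      + (-1) ^ 2 * (w : VField (Smooth S)) (Ω ![u, v])
      + ((-1) ^ (0 + (0 + 1)) * Ω ![bBracket D u v, w]
        + ((-1) ^ (0 + (1 + 1)) * Ω ![bBracket D u w, v]
          + (-1) ^ (1 + (1 + 1)) * Ω ![bBracket D v w, u])) = 0 := this
  linear_combination this'

/-- `IsInverse` only identifies `π♯ α` with a solution of `Ω(u, ·) = α`; that a solution exists is
nondegeneracy, applied to `α` restricted to `b`-fields. -/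
theorem exists_sharp_eq {π : Bivector (Smooth S)} (hΩ : IsStarLogSymplectic D Ω)
    (hπ : IsInverse D Ω π) (α : OneForm (Smooth S)) : ∃ u : bFields D, sharp π α = u ∧
      ∀ v : bFields D, Ω ![u, v] = α (v : VField (Smooth S)) := by
  obtain ⟨u, hu, -⟩ := hΩ.nondegenerate (α.comp (bFields D).subtype)
  exact ⟨u, hπ α u hu, hu⟩

theorem sharp_mem_rigged {π : Bivector (Smooth S)} (hΩ : IsStarLogSymplectic D Ω)
    (hπ : IsInverse D Ω π) (α : OneForm (Smooth S)) : sharp π α ∈ rigged Ω := by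
  obtain ⟨u, h, hu⟩ := exists_sharp_eq hΩ hπ α
  exact ⟨u, h.symm, α, hu⟩

/-- `π♯` as a linear map to the sections of the rigged algebroid. -/
noncomputable def sharpLinear {π : Bivector (Smooth S)} (hΩ : IsStarLogSymplectic D Ω)
    (hπ : IsInverse D Ω π) :
    OneForm (Smooth S) →ₗ[Smooth S] rigged Ω where
  toFun α := ⟨sharp π α, sharp_mem_rigged hΩ hπ α⟩
  map_add' α β := by
    obtain ⟨u, h, hu⟩ := exists_sharp_eq hΩ hπ α
    obtain ⟨w, h', hw⟩ := exists_sharp_eq hΩ hπ β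
    refine Subtype.ext ((hπ (α + β) (u + w) fun v => ?_).trans
      (by rw [Submodule.coe_add, ← h, ← h']; rfl))
    rw [bTwoForm_add_left, hu, hw, LinearMap.add_apply]
  map_smul' f α := by
    obtain ⟨u, h, hu⟩ := exists_sharp_eq hΩ hπ α
    refine Subtype.ext ((hπ (f • α) (f • u) fun v => ?_).trans
      (by rw [Submodule.coe_smul, ← h]; rfl))
    rw [bTwoForm_smul_left, hu, LinearMap.smul_apply, smul_eq_mul]

variable [T2Space S] [IsManifold (𝓡 2) ∞ S]

/-- One-forms are locally combinations of differentials, so that `π(α, β) = β(π♯ α)`. -/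
theorem bivector_apply (π : Bivector (Smooth S)) (α β : OneForm (Smooth S)) :
    π ![α, β] = β (sharp π α) := by
  ext p
  obtain ⟨x, y, hxy, -⟩ := exists_chart_coord p
  obtain ⟨g, hg1, hg⟩ := hxy.exists_cramer
  obtain ⟨X, Y, hXY⟩ := hxy
  -- `sharp` is defined by pairing with exact forms only; Cramer's rule writes a multiple of `β`,
  -- nonzero at `p`, through `dx` and `dy`.
  have hβ : (g * jac x y X Y) • β = (g * (Y y * β X - X y * β Y)) • dFun x
      + (g * (X x * β Y - Y x * β X)) • dFun y := by
    refine LinearMap.ext fun Z => ?_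
    have h := congrArg β (hg X Y Z)
    rw [map_smul, map_add, map_smul, map_smul] at h
    refine h.trans ?_
    change g * jac x y Z Y * β X + g * jac x y X Z * β Y
      = g * (Y y * β X - X y * β Y) * Z x + g * (X x * β Y - Y x * β X) * Z y
    simp only [jac]
    ring
  have h1 : g * jac x y X Y * π ![α, β] = g * jac x y X Y * β (sharp π α) := by
    rw [← bivector_smul_right, hβ, bivector_add_right, bivector_smul_right, bivector_smul_right]
    exact (congrArg (fun γ : OneForm (Smooth S) => γ (sharp π α)) hβ).symm
  have h2 : g p * jac x y X Y p * π ![α, β] p = g p * jac x y X Y p * β (sharp π α) p :=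
    congrArg (fun k : Smooth S => k p) h1
  refine mul_left_cancel₀ (mul_ne_zero ?_ hXY) h2
  rw [hg1.self_of_nhds]
  exact one_ne_zero

variable {π : Bivector (Smooth S)}

/-- `π♯` is a morphism of Lie algebroids, because `Ω` is closed. -/
theorem sharp_cotangentBracket (hΩ : IsStarLogSymplectic D Ω) (hπ : IsInverse D Ω π)
    (α β : OneForm (Smooth S)) :
    sharp π (cotangentBracket π α β) = ⁅sharp π α, sharp π β⁆ := by
  obtain ⟨u, h, hu⟩ := exists_sharp_eq hΩ hπ α
  obtain ⟨w, h', hw⟩ := exists_sharp_eq hΩ hπ β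
  refine (hπ _ (bBracket D u w) fun v => ?_).trans (by rw [h, h']; rfl)
  -- For a `b`-field `v` the brackets `[u, v]` and `[w, v]` are again `b`-fields. So every value of
  -- `α` and `β` becomes a value of `Ω`, and the required equality is `dΩ(u, w, v) = 0`.
  have hb : cotangentBracket π α β (v : VField (Smooth S))
      = ((u : VField (Smooth S)) (Ω ![w, v]) - Ω ![w, bBracket D u v])
        - ((w : VField (Smooth S)) (Ω ![u, v]) - Ω ![u, bBracket D w v])
        - (v : VField (Smooth S)) (Ω ![w, u]) := by
    rw [hw, hw, hw, hu, hu, ← h, ← bivector_apply, h]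
    change (sharp π α (β v) - β ⁅sharp π α, (v : VField (Smooth S))⁆)
      - (sharp π β (α v) - α ⁅sharp π β, (v : VField (Smooth S))⁆) - v.1 (π ![α, β]) = _
    rw [h, h']
    rfl
  rw [hb, bTwoForm_swap Ω (bBracket D u v) w, bTwoForm_swap Ω (bBracket D w v) u,
    bTwoForm_swap Ω u w, map_neg]
  linear_combination -bTwoForm_closed hΩ u w v

theorem sharpLinear_bijective [SecondCountableTopology S] (hD : IsStarDivisor D)
    (hΩ : IsStarLogSymplectic D Ω) (hπ : IsInverse D Ω π) :
    Function.Bijective (sharpLinear hΩ hπ) := by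
  constructor
  · refine (injective_iff_map_eq_zero _).2 fun α hα => ?_
    obtain ⟨u, h, hu⟩ := exists_sharp_eq hΩ hπ α
    have hu0 : u = 0 := Subtype.ext (h.symm.trans (congrArg Subtype.val hα))
    obtain ⟨ρ, hρ⟩ := exists_smooth_compl hD
    have hρ0 : ∀ i, ∀ q ∈ D i, ρ q = 0 := fun i q hq => by
      by_contra h
      exact (hρ q).1 h i hq
    refine LinearMap.ext fun X => smooth_ext hD fun q hq => ?_
    -- `Ω(0, ·) = α` on `b`-fields, and `ρ X` is one; cancelling `ρ` gives `α X = 0` off the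
    -- divisor.
    have h1 : ρ * α X = 0 := by
      have h2 := hu (mulField ρ hρ0 X)
      have h3 := bTwoForm_smul_left Ω 0 0 (mulField ρ hρ0 X)
      rw [zero_smul, zero_mul] at h3
      rw [hu0, h3] at h2
      exact (α.map_smul ρ X).symm.trans h2.symm
    have h2 : ρ q * α X q = 0 := congrArg (fun k : Smooth S => k q) h1
    exact (mul_eq_zero.1 h2).resolve_left ((hρ q).2 hq)
  · rintro ⟨_, u, rfl, α, hα⟩
    exact ⟨α, Subtype.ext (hπ α u hα)⟩

/-- `π♯` as an isomorphism from the one-forms to the sections of the zero tangent bundle. -/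
noncomputable def sharpEquiv [SecondCountableTopology S] (hD : IsStarDivisor D)
    (hΩ : IsStarLogSymplectic D Ω) (hπ : IsInverse D Ω π) :
    OneForm (Smooth S) ≃ₗ[Smooth S] zeroFields D :=
  (LinearEquiv.ofBijective _ (sharpLinear_bijective hD hΩ hπ)).trans
    (LinearEquiv.ofEq _ _ (rigged_eq_zeroFields hD hΩ))

theorem coe_sharpEquiv [SecondCountableTopology S] (hD : IsStarDivisor D)
    (hΩ : IsStarLogSymplectic D Ω) (hπ : IsInverse D Ω π) (α : OneForm (Smooth S)) :
    (sharpEquiv hD hΩ hπ α : VField (Smooth S)) = sharp π α := rfl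

theorem sharpEquiv_cotangentBracket [SecondCountableTopology S] (hD : IsStarDivisor D)
    (hΩ : IsStarLogSymplectic D Ω) (hπ : IsInverse D Ω π) (α β : OneForm (Smooth S)) :
    sharpEquiv hD hΩ hπ (cotangentBracket π α β)
      = zeroBracket D (sharpEquiv hD hΩ hπ α) (sharpEquiv hD hΩ hπ β) := by
  apply Subtype.ext
  rw [coe_sharpEquiv, sharp_cotangentBracket hΩ hπ]
  rfl

end Poisson

end StarLog


theorem lemma4p1 {S : Type*} [TopologicalSpace S] [T2Space S] [SecondCountableTopology S]
    [ChartedSpace (EuclideanSpace ℝ (Fin 2)) S] [IsManifold (𝓡 2) ∞ S]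
    {n : ℕ} (D : Fin n → Set S) (hD : StarLog.IsStarDivisor D)
    (Ω : StarLog.BTwoForm D) (hΩ : StarLog.IsStarLogSymplectic D Ω)
    (π : StarLog.Bivector (StarLog.Smooth S)) (hπ : StarLog.IsInverse D Ω π) :
    (∀ k : ℕ, Nonempty (StarLog.PoissonCohomology π k ≃ₗ[ℝ] StarLog.ZeroCohomology D k)) ∧
      StarLog.rigged Ω = StarLog.zeroFields D := by
  exact ⟨StarLog.nonempty_cohomology_equiv (StarLog.sharpEquiv hD hΩ hπ)
    (StarLog.coe_sharpEquiv hD hΩ hπ) (StarLog.sharpEquiv_cotangentBracket hD hΩ hπ),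
    StarLog.rigged_eq_zeroFields hD hΩ⟩
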